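/- Let $n\ge 1$ and let $\Delta\subset E$ be an $(n-1)$-simplex in a finite-dimensional real normed space $E$. Identify the $n$ facets $\Delta_1,\dots,\Delta_n$ of $\Delta$ (in any way) with the nodes of the affine Coxeter diagram $\widetilde A_n$, which is the cycle on $n$ nodes. A nonempty proper set $S$ of nodes that induces a connected subdiagram corresponds to the face $\Delta_S=\bigcap_{i\in S}\Delta_i$ of $\Delta$, of dimension $n-1-|S|$. To truncate a nonempty proper face $F$ of a polytope $P$ means to replace $P$ by $P\cap H$, where $H$ is a closed half-space whose bounding hyperplane strictly separates the vertices of $P$ lying on $F$ from all other vertices of $P$, and which contains the latter. Start with $\Delta$ and truncate successively all the faces $\Delta_S$ with $S$ connected (each time one truncates what is left of $\Delta_S$, namely its intersection with the current polytope), in increasing order of dimension; the order among faces of the same dimension and the separating hyperplanes are arbitrary, and each of the facets $\Delta_{\{i\}}$, whose truncation does not change the combinatorial type, may be included or left out. Then, for each such order, this can be carried out, and every polytope $Q$ that results is a cyclohedron $W_n$: $Q$ is a convex polytope of dimension $n-1$, and there is a bijection between the nonempty faces of $Q$ and the sets of pairwise non-intersecting symmetric diagonals of a $2n$-gon, which reverses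 inclusion and under which the faces of codimension $k$ correspond to the sets of $k$ symmetric diagonals. Here a symmetric diagonal of the centrally symmetric $2n$-gon is either a pair of distinct diagonals that are exchanged by the central symmetry, or a diameter; two symmetric diagonals are non-intersecting if no diagonal of the one crosses a diagonal of the other in the interior of the polygon. -/

import Mathlib

/-! Convex polytopes, their faces, and truncation of faces. -/

namespace Trunk

section Polytope

variable {E : Type*} [NormedAddCommGroup E] [NormedSpace ℝ E]

/-- A convex polytope: the convex hull of finitely many points. -/
def IsPolytope (P : Set E) : Prop :=
  ∃ s : Set E, s.Finite ∧ P = convexHull ℝ s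

/-- The dimension of (the affine hull of) a set. It is used for nonempty sets only. -/
noncomputable def dim (P : Set E) : ℕ :=
  Module.finrank ℝ (vectorSpan ℝ P)

/-- The poset, under inclusion, of the nonempty faces of `P` (`P` itself is one of them). -/
abbrev Faces (P : Set E) : Type _ :=
  {F : Set E // IsExposed ℝ P F ∧ F.Nonempty}

/-- `Q` is obtained from the polytope `P` by truncating its nonempty proper face `F`: a hyperplane
`l = c` strictly separates the vertices of `P` on `F` from all the other vertices of `P`, and
`Q` is the part of `P` on the side that does not contain `F`. -/
def IsTruncation (P F Q : Set E) : Prop :=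
  (IsExposed ℝ P F ∧ F.Nonempty ∧ F ≠ P) ∧
    ∃ (l : StrongDual ℝ E) (c : ℝ),
      (∀ x ∈ P.extremePoints ℝ, (x ∈ F → c < l x) ∧ (x ∉ F → l x < c)) ∧
      Q = {x ∈ P | l x ≤ c}

/-- `Q` is obtained from `P` by truncating successively the faces in the list `Fs`. Each time one
truncates `F ∩ P`, which is what the earlier truncations have left of the original face `F`. -/
def IsIteratedTruncation : Set E → List (Set E) → Set E → Prop
  | P, [], Q => Q = P
  | P, F :: Fs, Q => ∃ R : Set E, IsTruncation P (F ∩ P) R ∧ IsIteratedTruncation R Fs Q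

/-- The simplex with vertices `v i` (which are affinely independent where this is used). -/
def simplex {n : ℕ} (v : Fin n → E) : Set E :=
  convexHull ℝ (Set.range v)

/-- The facet of the simplex opposite to the vertex `v i`. -/
def facet {n : ℕ} (v : Fin n → E) (i : Fin n) : Set E :=
  convexHull ℝ (v '' {i}ᶜ)

/-- The face of the simplex corresponding to a set `S` of nodes (i.e. of facets): the intersection
of the facets in `S`. -/
def simplexFace {n : ℕ} (v : Fin n → E) (S : Finset (Fin n)) : Set E :=
  {x ∈ simplex v | ∀ i ∈ S, x ∈ facet v i}

end Polytope

/-! Subdiagrams of the affine diagram, which is a cycle on `n` nodes. -/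

/-- `S` spans a connected (in particular nonempty), proper subdiagram of the cycle on `n` nodes.
The whole cycle is left out because the `n` facets of an `(n-1)`-simplex have no common point. -/
def IsConnectedSubdiagram {n : ℕ} (S : Finset (Fin n)) : Prop :=
  ((SimpleGraph.cycleGraph n).induce (S : Set (Fin n))).Connected ∧ S ≠ Finset.univ

/-- `L` lists, without repetition and in increasing (i.e. nondecreasing) order of the dimension of
the corresponding faces of the simplex, the connected proper subdiagrams of the cycle.
Single nodes correspond to facets; cutting off a facet does not change the combinatorial type, so
the list is free to contain all, some or none of the single nodes. -/
def IsTruncationOrder {E : Type*} [NormedAddCommGroup E] [NormedSpace ℝ E] {n : ℕ}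
    (v : Fin n → E) (L : List (Finset (Fin n))) : Prop :=
  L.Nodup ∧
  (∀ S ∈ L, IsConnectedSubdiagram S) ∧
  (∀ S : Finset (Fin n), IsConnectedSubdiagram S → 2 ≤ S.card → S ∈ L) ∧
  L.Pairwise (fun S T => dim (simplexFace v S) ≤ dim (simplexFace v T))

/-! Centrally symmetric dissections of the `2n`-gon. Its vertices are, in cyclic order,
`0, …, 2n - 1`. -/

/-- The opposite vertex of the `2n`-gon. -/
def antipode {n : ℕ} (a : Fin (2 * n)) : Fin (2 * n) :=
  ⟨(a.val + n) % (2 * n), Nat.mod_lt _ (Nat.zero_lt_of_lt a.isLt)⟩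

/-- A diagonal joins two vertices that are neither equal nor neighbours on the `2n`-gon. -/
def IsDiagonal {n : ℕ} (d : Sym2 (Fin (2 * n))) : Prop :=
  ∃ a b : Fin (2 * n), d = s(a, b) ∧ a.val + 1 < b.val ∧ b.val + 1 < a.val + 2 * n

/-- Two diagonals intersect (in interior points of the polygon, being distinct):
their end points alternate. -/
def Cross {n : ℕ} (d e : Sym2 (Fin (2 * n))) : Prop :=
  ∃ a b a' b' : Fin (2 * n), a < b ∧ b < a' ∧ a' < b' ∧
    ((d = s(a, a') ∧ e = s(b, b')) ∨ (e = s(a, a') ∧ d = s(b, b')))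

/-- A symmetric diagonal: a pair of centrally symmetric diagonals of the `2n`-gon, or a diameter
(in this case the two members of the pair coincide). -/
abbrev SymDiagonal (n : ℕ) : Type :=
  {c : Finset (Sym2 (Fin (2 * n))) //
    ∃ d : Sym2 (Fin (2 * n)), IsDiagonal d ∧ c = {d, d.map antipode}}

/-- The sets of pairwise non-intersecting symmetric diagonals of the `2n`-gon, ordered by
inclusion. -/
abbrev SymDissection (n : ℕ) : Type :=
  {D : Finset (SymDiagonal n) //
    ∀ c ∈ D, ∀ c' ∈ D, ∀ d ∈ c.1, ∀ d' ∈ c'.1, ¬ Cross d d'}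

/-- `P` is a cyclohedron `W_n`: a convex polytope of dimension `n - 1` whose poset of nonempty
faces is isomorphic to the poset of sets of non-intersecting symmetric diagonals of the `2n`-gon
under reverse inclusion, where the faces of codimension `k` correspond to the sets of `k` symmetric
diagonals. -/
def IsCyclohedron {E : Type*} [NormedAddCommGroup E] [NormedSpace ℝ E]
    (n : ℕ) (P : Set E) : Prop :=
  IsPolytope P ∧ P.Nonempty ∧ dim P + 1 = n ∧
    ∃ e : Faces P ≃o (SymDissection n)ᵒᵈ,
      ∀ F : Faces P, dim F.1 + (OrderDual.ofDual (e F)).1.card = dim P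

end Trunk

/-! Truncating a face of a simple polytope gives a simple polytope, and on the dual simplicial
complex it is a stellar subdivision. The simplex is written as a system of inequalities whose tight
functionals are independent at every point; its faces are then the sets σ of inequalities with
nonempty `tightFace`, of codimension |σ|. A truncation adds one inequality and keeps the system
simple, with the new face sets determined by the old ones (`IsSimpleSystem.truncate`). Hence the
result does not depend on the separating hyperplanes, and the face poset is the recursively defined
`SubdividedComplex`.

Increasing dimension means decreasing number of nodes, so no face has disappeared when its turn
comes. Unfolding the recursion shows that a simplex is a set of facets whose node sets do not cover
any truncated set, or the whole cycle, by smaller members. Two incompatible connected sets have a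
connected union, while a connected set covered by pairwise compatible sets lies in one of them; so
the condition amounts to pairwise compatibility (`subdividedComplex_iff_compatible`).

Proper connected sets of nodes are arcs of the cycle. Reading the vertices of the 2n-gon modulo n,
the diagonal from `fst` to `snd` cuts off the arc strictly between them; diameters give the arcs
that omit one node. Compatible arcs are exactly those whose symmetric diagonals do not intersect
(`not_cross_iff_compatible`). -/

namespace Trunk

/-! ### Faces of a simple polytope given by inequalities. -/

section SimpleSystem

open Set Filter Topology

variable {E : Type*} [NormedAddCommGroup E] [NormedSpace ℝ E] {ι : Type*}

/-- The set of points of `M` at which all the affine functionals `a i` are nonnegative. -/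
def halfspacePolytope (M : AffineSubspace ℝ E) (a : ι → E →ᵃ[ℝ] ℝ) : Set E :=
  {x | x ∈ M ∧ ∀ i, 0 ≤ a i x}

/-- The part of the polytope on which the functionals in `σ` vanish. -/
def tightFace (M : AffineSubspace ℝ E) (a : ι → E →ᵃ[ℝ] ℝ) (σ : Finset ι) : Set E :=
  {x | x ∈ halfspacePolytope M a ∧ ∀ i ∈ σ, a i x = 0}

/-- A bounded system of inequalities is simple if, at every point of the polytope, the functionals
that vanish there are linearly independent on the direction of `M`. -/
structure IsSimpleSystem (M : AffineSubspace ℝ E) (a : ι → E →ᵃ[ℝ] ℝ) : Prop where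
  compact : IsCompact (halfspacePolytope M a)
  indep : ∀ x ∈ halfspacePolytope M a, ∀ i, a i x = 0 →
    ∃ u ∈ M.direction, (a i).linear u = 1 ∧ ∀ j, j ≠ i → a j x = 0 → (a j).linear u = 0

variable {M : AffineSubspace ℝ E} {a : ι → E →ᵃ[ℝ] ℝ}

theorem affine_apply_add (f : E →ᵃ[ℝ] ℝ) (x u : E) : f (x + u) = f x + f.linear u := by
  have := f.map_vadd x u
  simp only [vadd_eq_add] at this
  rw [add_comm, this, add_comm]

theorem affine_apply_sub (f : E →ᵃ[ℝ] ℝ) (x y : E) : f.linear (x - y) = f x - f y := by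
  have := f.linearMap_vsub x y
  simpa using this

theorem affine_apply_combo (f : E →ᵃ[ℝ] ℝ) {x y : E} {s t : ℝ} (hst : s + t = 1) :
    f (s • x + t • y) = s * f x + t * f y := by
  obtain rfl : s = 1 - t := by linarith
  have : (1 - t) • x + t • y = x + t • (y - x) := by module
  rw [this, affine_apply_add, map_smul, affine_apply_sub, smul_eq_mul]
  ring

theorem convex_setOf_affine_eq (f : E →ᵃ[ℝ] ℝ) (c : ℝ) : Convex ℝ {x | f x = c} := by
  intro x hx y hy s t _ _ hst
  simp only [mem_ofPred_eq] at *
  rw [affine_apply_combo f hst, hx, hy, ← add_mul, hst, one_mul]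

theorem convex_setOf_affine_nonneg (f : E →ᵃ[ℝ] ℝ) : Convex ℝ {x | 0 ≤ f x} := by
  intro x hx y hy s t hs ht hst
  simp only [mem_ofPred_eq] at *
  rw [affine_apply_combo f hst]
  positivity

theorem convex_setOf_affine_pos (f : E →ᵃ[ℝ] ℝ) : Convex ℝ {x | 0 < f x} := by
  intro x hx y hy s t hs ht hst
  simp only [mem_ofPred_eq] at *
  rw [affine_apply_combo f hst]
  rcases hs.eq_or_lt with rfl | hs
  · simp_all
  · positivity

theorem convex_setOf_affine_neg (f : E →ᵃ[ℝ] ℝ) : Convex ℝ {x | f x < 0} := by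
  intro x hx y hy s t hs ht hst
  simp only [mem_ofPred_eq] at *
  rw [affine_apply_combo f hst]
  rcases hs.eq_or_lt with rfl | hs
  · simp_all
  · nlinarith [mul_pos hs (neg_pos.2 hx), mul_nonneg ht (neg_pos.2 hy).le]

theorem convex_halfspacePolytope : Convex ℝ (halfspacePolytope M a) := by
  have : halfspacePolytope M a = (M : Set E) ∩ ⋂ i, {x | 0 ≤ a i x} := by
    ext; simp [halfspacePolytope]
  rw [this]
  exact M.convex.inter (convex_iInter fun i => convex_setOf_affine_nonneg _)

theorem tightFace_eq (σ : Finset ι) :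
    tightFace M a σ = halfspacePolytope M a ∩ ⋂ i ∈ σ, {x | a i x = 0} := by
  ext; simp [tightFace]

theorem convex_tightFace (σ : Finset ι) : Convex ℝ (tightFace M a σ) := by
  rw [tightFace_eq]
  exact convex_halfspacePolytope.inter
    (convex_iInter fun i => convex_iInter fun _ => convex_setOf_affine_eq _ _)

theorem tightFace_empty : tightFace M a ∅ = halfspacePolytope M a := by
  ext; simp [tightFace]

theorem tightFace_anti {σ τ : Finset ι} (h : σ ⊆ τ) : tightFace M a τ ⊆ tightFace M a σ :=
  fun _ hx => ⟨hx.1, fun i hi => hx.2 i (h hi)⟩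

section

variable [FiniteDimensional ℝ E]

/-- Minus the sum of the functionals in σ exposes the face, since a sum of nonnegative terms
vanishes only if each term does. -/
theorem isExposed_tightFace (σ : Finset ι) :
    IsExposed ℝ (halfspacePolytope M a) (tightFace M a σ) := by
  rintro ⟨z, hz⟩
  let f : E →ₗ[ℝ] ℝ := - ∑ i ∈ σ, (a i).linear
  have hf : ∀ x y, f x - f y = ∑ i ∈ σ, a i y - ∑ i ∈ σ, a i x := by
    intro x y
    rw [← map_sub, ← Finset.sum_sub_distrib]
    simp only [f, LinearMap.neg_apply, LinearMap.sum_apply, affine_apply_sub,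
      ← Finset.sum_neg_distrib, neg_sub]
  refine ⟨LinearMap.toContinuousLinearMap f, ?_⟩
  ext x
  simp only [tightFace, mem_ofPred_eq, LinearMap.coe_toContinuousLinearMap']
  refine and_congr_right fun hx => ⟨fun h0 y hy => ?_, fun hm i hi => ?_⟩
  · have := hf x y
    rw [Finset.sum_eq_zero h0, sub_zero] at this
    have := Finset.sum_nonneg fun i (_ : i ∈ σ) => hy.2 i
    linarith
  · have := hf x z
    rw [Finset.sum_eq_zero hz.2, zero_sub] at this
    have h1 := hm z hz.1
    have h2 : ∑ i ∈ σ, a i x = 0 :=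
      le_antisymm (by linarith) (Finset.sum_nonneg fun i _ => hx.2 i)
    exact (Finset.sum_eq_zero_iff_of_nonneg fun i _ => hx.2 i).1 h2 i hi

theorem isClosed_setOf_affine_eq (f : E →ᵃ[ℝ] ℝ) (c : ℝ) : IsClosed {x | f x = c} :=
  isClosed_eq (AffineMap.continuous_of_finiteDimensional f) continuous_const

theorem IsSimpleSystem.isCompact_tightFace (h : IsSimpleSystem M a) (σ : Finset ι) :
    IsCompact (tightFace M a σ) := by
  rw [tightFace_eq]
  exact h.compact.inter_right
    (isClosed_iInter fun i => isClosed_iInter fun _ => isClosed_setOf_affine_eq _ _)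

end

variable [Fintype ι]

theorem IsSimpleSystem.exists_direction (h : IsSimpleSystem M a) {x : E}
    (hx : x ∈ halfspacePolytope M a) (f : ι → ℝ) :
    ∃ u ∈ M.direction, ∀ i, a i x = 0 → (a i).linear u = f i := by
  classical
  have h' : ∀ i, ∃ u ∈ M.direction, a i x = 0 →
      (a i).linear u = 1 ∧ ∀ j, j ≠ i → a j x = 0 → (a j).linear u = 0 := by
    intro i
    by_cases hi : a i x = 0
    · obtain ⟨u, hu, h1⟩ := h.indep x hx i hi
      exact ⟨u, hu, fun _ => h1⟩
    · exact ⟨0, zero_mem _, fun h => absurd h hi⟩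
  choose u hu h1 using h'
  refine ⟨∑ i with a i x = 0, f i • u i,
    Submodule.sum_mem _ fun i _ => Submodule.smul_mem _ _ (hu i), fun i hi => ?_⟩
  rw [map_sum, Finset.sum_eq_single i]
  · simp [(h1 i hi).1]
  · intro j hj hji
    simp only [Finset.mem_filter, Finset.mem_univ, true_and] at hj
    simp [(h1 j hj).2 i hji.symm hi]
  · intro hn; simp [hi] at hn

/-- One can move from a point of the polytope along any direction that does not decrease the
functionals vanishing there. -/
theorem exists_move {x u : E} (hx : x ∈ halfspacePolytope M a) (hu : u ∈ M.direction)
    (h0 : ∀ i, a i x = 0 → 0 ≤ (a i).linear u) :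
    ∃ ε : ℝ, 0 < ε ∧ x + ε • u ∈ halfspacePolytope M a ∧ ∀ i, 0 < a i x → 0 < a i (x + ε • u) := by
  have key : ∀ᶠ t : ℝ in 𝓝[>] 0, ∀ i, 0 < a i x → 0 < a i x + t * (a i).linear u := by
    refine eventually_all.2 fun i => ?_
    by_cases hi : 0 < a i x
    · have : Tendsto (fun t : ℝ => a i x + t * (a i).linear u) (𝓝[>] 0)
          (𝓝 (a i x + 0 * (a i).linear u)) :=
        ((by fun_prop : Continuous fun t : ℝ => a i x + t * (a i).linear u).tendsto 0).mono_left
          nhdsWithin_le_nhds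
      rw [zero_mul, add_zero] at this
      filter_upwards [this.eventually_const_lt hi] with t ht _ using ht
    · exact Eventually.of_forall fun _ h => absurd h hi
  obtain ⟨ε, h1, hε⟩ := (key.and self_mem_nhdsWithin).exists
  have hval : ∀ i, a i (x + ε • u) = a i x + ε * (a i).linear u := fun i => by
    rw [affine_apply_add, map_smul, smul_eq_mul]
  refine ⟨ε, hε, ⟨?_, fun i => ?_⟩, fun i hi => ?_⟩
  · rw [add_comm]
    exact AffineSubspace.vadd_mem_of_mem_direction (Submodule.smul_mem _ _ hu) hx.1
  · rw [hval]
    rcases (hx.2 i).eq_or_lt with hi | hi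
    · rw [← hi, zero_add]; exact mul_nonneg (le_of_lt hε) (h0 i hi.symm)
    · exact (h1 i hi).le
  · rw [hval]; exact h1 i hi

/-- By independence one can leave a point of the face in a direction that keeps σ tight and
increases every other tight functional. Such a generic point recovers σ from the face. -/
theorem IsSimpleSystem.exists_generic (h : IsSimpleSystem M a) {σ : Finset ι}
    (hσ : (tightFace M a σ).Nonempty) :
    ∃ y ∈ halfspacePolytope M a, ∀ i, a i y = 0 ↔ i ∈ σ := by
  classical
  obtain ⟨x, hx, hxσ⟩ := hσ
  obtain ⟨u, hu, hf⟩ := h.exists_direction hx (fun i => if i ∈ σ then 0 else 1)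
  obtain ⟨ε, hε, h1, h2⟩ := exists_move hx hu (fun i hi => by rw [hf i hi]; split_ifs <;> norm_num)
  refine ⟨_, h1, fun i => ?_⟩
  rcases (hx.2 i).eq_or_lt with hi | hi
  · rw [affine_apply_add, map_smul, ← hi, hf i hi.symm]
    split_ifs with h <;> simp [h, hε.ne']
  · exact ⟨fun h => absurd h (h2 i hi).ne', fun h => absurd (hxσ i h) hi.ne'⟩

theorem IsSimpleSystem.tightFace_subset_iff (h : IsSimpleSystem M a) {σ τ : Finset ι}
    (hτ : (tightFace M a τ).Nonempty) : tightFace M a τ ⊆ tightFace M a σ ↔ σ ⊆ τ := by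
  refine ⟨fun hs i hi => ?_, tightFace_anti⟩
  obtain ⟨y, hy, hyt⟩ := h.exists_generic hτ
  exact (hyt i).1 ((hs ⟨hy, fun j hj => (hyt j).2 hj⟩).2 i hi)

/-- A direction that is tangent to the smallest face containing `x` can be followed both ways. -/
theorem exists_move_both {x u : E} (hx : x ∈ halfspacePolytope M a) (hu : u ∈ M.direction)
    (h0 : ∀ i, a i x = 0 → (a i).linear u = 0) :
    ∃ ε : ℝ, 0 < ε ∧ x + ε • u ∈ halfspacePolytope M a ∧ x - ε • u ∈ halfspacePolytope M a := by
  obtain ⟨ε, hε, h1, -⟩ := exists_move hx hu (fun i hi => (h0 i hi).ge)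
  obtain ⟨δ, hδ, h2, -⟩ := exists_move hx (neg_mem hu)
    (fun i hi => by rw [map_neg, h0 i hi, neg_zero])
  have shrink : ∀ (w : E) (t : ℝ), 0 < t → x + t • w ∈ halfspacePolytope M a →
      ∀ s, 0 ≤ s → s ≤ t → x + s • w ∈ halfspacePolytope M a := by
    intro w t ht hw s hs hst
    have := convex_halfspacePolytope hx hw (show 0 ≤ 1 - s / t from
      sub_nonneg.2 ((div_le_one ht).2 hst)) (show 0 ≤ s / t by positivity) (by ring)
    convert this using 1
    have hst' : s = s / t * t := by field_simp
    conv_lhs => rw [hst']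
    module
  refine ⟨min ε δ, lt_min hε hδ, shrink u ε hε h1 _ (lt_min hε hδ).le (min_le_left _ _), ?_⟩
  have := shrink (-u) δ hδ h2 _ (lt_min hε hδ).le (min_le_right _ _)
  rwa [smul_neg, ← sub_eq_add_neg] at this

theorem mem_vectorSpan_tightFace {σ : Finset ι} {y : E} (hy : y ∈ halfspacePolytope M a)
    (hyσ : ∀ i, a i y = 0 ↔ i ∈ σ) (u : E) :
    u ∈ vectorSpan ℝ (tightFace M a σ) ↔
      u ∈ M.direction ∧ ∀ i ∈ σ, (a i).linear u = 0 := by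
  constructor
  · intro hu
    rw [vectorSpan_def] at hu
    refine Submodule.span_induction ?_ (by simp) ?_ ?_ hu
    · rintro _ ⟨x, hx, z, hz, rfl⟩
      refine ⟨AffineSubspace.vsub_mem_direction hx.1.1 hz.1.1, fun i hi => ?_⟩
      simp only [vsub_eq_sub]
      rw [affine_apply_sub, hx.2 i hi, hz.2 i hi, sub_zero]
    · rintro x z - - ⟨h1, h2⟩ ⟨h3, h4⟩
      exact ⟨add_mem h1 h3, fun i hi => by rw [map_add, h2 i hi, h4 i hi, add_zero]⟩
    · rintro t x - ⟨h1, h2⟩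
      exact ⟨Submodule.smul_mem _ _ h1, fun i hi => by rw [map_smul, h2 i hi, smul_zero]⟩
  · rintro ⟨hu, h0⟩
    obtain ⟨ε, hε, h1, -⟩ := exists_move hy hu (fun i hi => (h0 i ((hyσ i).1 hi)).ge)
    have hyf : y ∈ tightFace M a σ := ⟨hy, fun i hi => (hyσ i).2 hi⟩
    have hzf : y + ε • u ∈ tightFace M a σ := ⟨h1, fun i hi => by
      rw [affine_apply_add, map_smul, h0 i hi, (hyσ i).2 hi]; simp⟩
    have := vsub_mem_vectorSpan ℝ hzf hyf
    simp only [vsub_eq_sub, add_sub_cancel_left] at this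
    simpa [smul_smul, inv_mul_cancel₀ hε.ne'] using Submodule.smul_mem _ ε⁻¹ this

/-- Take a point x of F with fewest tight functionals. Midpoints with other points of F show that
these are tight on all of F. Conversely, from x one can step away from any point y at which they are
tight, so the exposing functional, maximal at x, cannot be smaller at y. -/
theorem exists_eq_tightFace {F : Set E} (hF : IsExposed ℝ (halfspacePolytope M a) F)
    (hne : F.Nonempty) : ∃ σ : Finset ι, F = tightFace M a σ := by
  classical
  obtain ⟨l, hl⟩ := hF hne
  let T : E → Finset ι := fun x => {i | a i x = 0}
  obtain ⟨x, hx, hmin⟩ := exists_minimalFor_of_wellFoundedLT (· ∈ F) (fun x => (T x).card) hne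
  have hxP := hl ▸ hx
  refine ⟨T x, subset_antisymm (fun y hy => ?_) (fun y hy => ?_)⟩
  · have hyP := hl ▸ hy
    refine ⟨hyP.1, fun i hi => ?_⟩
    by_contra hne'
    have hi' : a i x = 0 := by simpa [T] using hi
    set m : E := (2⁻¹ : ℝ) • x + (2⁻¹ : ℝ) • y with hm
    have hma : ∀ j, a j m = 2⁻¹ * a j x + 2⁻¹ * a j y := fun j =>
      affine_apply_combo _ (by norm_num)
    have hmP : m ∈ halfspacePolytope M a :=
      convex_halfspacePolytope hxP.1 hyP.1 (by norm_num) (by norm_num) (by norm_num)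
    have hmF : m ∈ F := by
      rw [hl]
      refine ⟨hmP, fun z hz => ?_⟩
      have h1 := hxP.2 z hz
      have h2 := hyP.2 z hz
      simp only [hm, map_add, map_smul, smul_eq_mul]
      linarith
    have hsub : T m ⊂ T x := by
      refine Finset.ssubset_iff_subset_ne.2 ⟨fun j hj => ?_, fun he => ?_⟩
      · have hj' : a j m = 0 := by simpa [T] using hj
        rw [hma] at hj'
        have := hxP.1.2 j
        have := hyP.1.2 j
        simp only [T, Finset.mem_filter, Finset.mem_univ, true_and]
        linarith
      · have : i ∈ T m := he ▸ hi
        have hj' : a i m = 0 := by simpa [T] using this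
        rw [hma, hi'] at hj'
        exact hne' (by linarith)
    have := Finset.card_lt_card hsub
    exact absurd (hmin hmF this.le) (not_le.2 this)
  · rw [hl]
    have hd : y - x ∈ M.direction := AffineSubspace.vsub_mem_direction hy.1.1 hxP.1.1
    obtain ⟨ε, hε, -, h2⟩ := exists_move_both hxP.1 hd (fun i hi => by
      rw [affine_apply_sub, hi, hy.2 i (by simpa [T] using hi), sub_zero])
    have h3 := hxP.2 _ h2
    rw [map_sub, map_smul, map_sub, smul_eq_mul] at h3
    refine ⟨hy.1, fun z hz => (hxP.2 z hz).trans ?_⟩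
    have : 0 ≤ ε * (l y - l x) := by linarith
    have := nonneg_of_mul_nonneg_right this hε
    linarith

/-- A vertex is determined by its tight functionals: if two vertices had the same ones, one could
move from the first both ways along the line joining them. -/
theorem finite_extremePoints_halfspacePolytope :
    ((halfspacePolytope M a).extremePoints ℝ).Finite := by
  classical
  refine Set.Finite.of_injOn (f := fun x => ({i | a i x = 0} : Finset ι)) (t := Set.univ)
    (fun _ _ => mem_univ _) ?_ Set.finite_univ
  intro x hx y hy hxy
  have hT : ∀ i, a i x = 0 ↔ a i y = 0 := fun i => by
    have := congrArg (i ∈ ·) hxy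
    simpa using this
  have hd : y - x ∈ M.direction := AffineSubspace.vsub_mem_direction hy.1.1 hx.1.1
  obtain ⟨ε, hε, h1, h2⟩ := exists_move_both hx.1 hd (fun i hi => by
      rw [affine_apply_sub, hi, (hT i).1 hi, sub_zero])
  have hseg : x ∈ openSegment ℝ (x + ε • (y - x)) (x - ε • (y - x)) :=
    ⟨2⁻¹, 2⁻¹, by norm_num, by norm_num, by norm_num, by module⟩
  have := hx.2 h1 h2 hseg
  have h3 : ε • (y - x) = 0 := by simpa using this
  rcases smul_eq_zero.1 h3 with h | h
  · exact absurd h hε.ne'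
  · exact (sub_eq_zero.1 h).symm

variable [FiniteDimensional ℝ E]

/-- Rank-nullity: at a generic point the functionals in σ map the direction of M onto ℝ^σ, and the
kernel is the direction of the face. -/
theorem IsSimpleSystem.dim_tightFace (h : IsSimpleSystem M a) {σ : Finset ι}
    (hσ : (tightFace M a σ).Nonempty) :
    dim (tightFace M a σ) + σ.card = Module.finrank ℝ M.direction := by
  classical
  obtain ⟨y, hy, hyσ⟩ := h.exists_generic hσ
  let g : M.direction →ₗ[ℝ] (σ → ℝ) :=
    LinearMap.pi fun i => (a i.1).linear ∘ₗ M.direction.subtype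
  have hg : Function.Surjective g := by
    intro f
    obtain ⟨u, hu, hf⟩ := h.exists_direction hy (fun i => if hi : i ∈ σ then f ⟨i, hi⟩ else 0)
    refine ⟨⟨u, hu⟩, funext fun i => ?_⟩
    have := hf i.1 ((hyσ i.1).2 i.2)
    simpa [g] using this
  have hk : vectorSpan ℝ (tightFace M a σ) = (LinearMap.ker g).map M.direction.subtype := by
    ext u
    rw [mem_vectorSpan_tightFace hy hyσ]
    simp only [Submodule.mem_map, LinearMap.mem_ker, Submodule.subtype_apply, Subtype.exists,
      exists_and_right, exists_eq_right, g]
    constructor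
    · rintro ⟨hu, h0⟩
      exact ⟨hu, funext fun i => by simpa using h0 i.1 i.2⟩
    · rintro ⟨hu, h0⟩
      exact ⟨hu, fun i hi => by simpa using congrFun h0 ⟨i, hi⟩⟩
  have := LinearMap.finrank_range_add_finrank_ker g
  rw [LinearMap.range_eq_top.2 hg, finrank_top, Module.finrank_fintype_fun_eq_card,
    Fintype.card_coe] at this
  rw [dim, hk, Submodule.finrank_map_subtype_eq, add_comm, this]

/-- Every face lies in the convex hull of the vertices of the polytope that it contains. -/
theorem IsSimpleSystem.tightFace_subset_of_extremePoints (h : IsSimpleSystem M a) (σ : Finset ι)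
    {C : Set E} (hC : Convex ℝ C)
    (hs : ∀ x ∈ (halfspacePolytope M a).extremePoints ℝ, x ∈ tightFace M a σ → x ∈ C) :
    tightFace M a σ ⊆ C := by
  have hext : (tightFace M a σ).extremePoints ℝ ⊆ (halfspacePolytope M a).extremePoints ℝ :=
    (isExposed_tightFace σ).isExtreme.extremePoints_subset_extremePoints
  have hfin := finite_extremePoints_halfspacePolytope.subset hext
  rw [← closure_convexHull_extremePoints (h.isCompact_tightFace σ) (convex_tightFace σ),
    (hfin.isClosed_convexHull ℝ).closure_eq]
  exact convexHull_min (fun x hx => hs x (hext hx) hx.1) hC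

theorem IsSimpleSystem.isPolytope (h : IsSimpleSystem M a) :
    IsPolytope (halfspacePolytope M a) := by
  refine ⟨_, finite_extremePoints_halfspacePolytope (M := M) (a := a), subset_antisymm ?_ ?_⟩
  · have := h.tightFace_subset_of_extremePoints ∅
      (convex_convexHull ℝ ((halfspacePolytope M a).extremePoints ℝ))
      fun x hx _ => subset_convexHull ℝ _ hx
    rwa [tightFace_empty] at this
  · exact convexHull_min extremePoints_subset convex_halfspacePolytope

/-- The face poset of the polytope of a simple system. -/
noncomputable def IsSimpleSystem.facesEquiv (h : IsSimpleSystem M a) :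
    {σ : Finset ι // (tightFace M a σ).Nonempty}ᵒᵈ ≃o Faces (halfspacePolytope M a) where
  toEquiv := Equiv.ofBijective
    (fun σ => ⟨tightFace M a (OrderDual.ofDual σ).1, isExposed_tightFace _,
      (OrderDual.ofDual σ).2⟩) <| by
    constructor
    · intro σ τ he
      have he' := congrArg Subtype.val he
      refine Subtype.ext (subset_antisymm ?_ ?_)
      · exact (h.tightFace_subset_iff (OrderDual.ofDual τ).2).1 he'.ge
      · exact (h.tightFace_subset_iff (OrderDual.ofDual σ).2).1 he'.le
    · rintro ⟨F, hF, hne⟩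
      obtain ⟨σ, rfl⟩ := exists_eq_tightFace hF hne
      exact ⟨OrderDual.toDual ⟨σ, hne⟩, rfl⟩
  map_rel_iff' := by
    intro σ τ
    exact h.tightFace_subset_iff (OrderDual.ofDual σ).2

end SimpleSystem

/-! ### Truncation as stellar subdivision. -/

section Truncation

open Set Filter Topology

variable {E : Type*} [NormedAddCommGroup E] [NormedSpace ℝ E] [FiniteDimensional ℝ E]
  {ι : Type*} [Fintype ι] {M : AffineSubspace ℝ E} {a : ι → E →ᵃ[ℝ] ℝ}

/-- Truncating a face of a simple polytope gives a simple polytope; on the dual simplicial complex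
this is a stellar subdivision. -/
theorem IsSimpleSystem.truncate [DecidableEq ι] (h : IsSimpleSystem M a) {σ : Finset ι} {Q : Set E}
    {i : ι} (hi : ∀ x, a i x = 1)
    (hQ : IsTruncation (halfspacePolytope M a) (tightFace M a σ) Q) :
    ∃ b : E →ᵃ[ℝ] ℝ, IsSimpleSystem M (Function.update a i b) ∧
      Q = halfspacePolytope M (Function.update a i b) ∧
      ∀ τ, i ∉ τ →
        ((tightFace M (Function.update a i b) τ).Nonempty ↔
          (tightFace M a τ).Nonempty ∧ ¬ σ ⊆ τ) ∧
        ((tightFace M (Function.update a i b) (insert i τ)).Nonempty ↔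
          (tightFace M a (τ ∪ σ)).Nonempty ∧ ¬ σ ⊆ τ) := by
  obtain ⟨-, l, c, hv, rfl⟩ := hQ
  let b : E →ᵃ[ℝ] ℝ := AffineMap.const ℝ E c - l.toLinearMap.toAffineMap
  have hb : ∀ x, b x = c - l x := fun x => rfl
  have hvF : ∀ x ∈ (halfspacePolytope M a).extremePoints ℝ, x ∈ tightFace M a σ → b x < 0 :=
    fun x hx hF => by rw [hb]; linarith [(hv x hx).1 hF]
  have hvN : ∀ x ∈ (halfspacePolytope M a).extremePoints ℝ, x ∉ tightFace M a σ → 0 < b x :=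
    fun x hx hF => by rw [hb]; linarith [(hv x hx).2 hF]
  -- If b were nowhere positive on the face of τ, all its vertices, hence the face itself, would lie
  -- in the truncated face.
  have hpos : ∀ τ, (tightFace M a τ).Nonempty → ¬ σ ⊆ τ → ∃ x ∈ tightFace M a τ, 0 < b x := by
    intro τ hne hsub
    by_contra! hcon
    refine hsub ((h.tightFace_subset_iff hne).1
      (h.tightFace_subset_of_extremePoints τ (convex_tightFace σ) fun x hx hxτ => ?_))
    by_contra hxF
    exact absurd (hvN x hx hxF) (not_lt.2 (hcon x hxτ))
  have hneg : ∀ τ, σ ⊆ τ → ∀ x ∈ tightFace M a τ, b x < 0 := fun τ hsub =>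
    h.tightFace_subset_of_extremePoints τ (convex_setOf_affine_neg b)
      fun x hx hxτ => hvF x hx (tightFace_anti hsub hxτ)
  have hdis : ∀ τ, ¬ (tightFace M a (τ ∪ σ)).Nonempty → ∀ x ∈ tightFace M a τ, 0 < b x :=
    fun τ hne => h.tightFace_subset_of_extremePoints τ (convex_setOf_affine_pos b)
      fun x hx hxτ => hvN x hx fun hxF => hne ⟨x, hxτ.1, fun j hj =>
        (Finset.mem_union.1 hj).elim (hxτ.2 j) (hxF.2 j)⟩
  have hupd : ∀ j, j ≠ i → Function.update a i b j = a j := fun j hj =>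
    Function.update_of_ne hj _ _
  have hupi : Function.update a i b i = b := Function.update_self _ _ _
  have hQ : {x | x ∈ halfspacePolytope M a ∧ l x ≤ c} =
      halfspacePolytope M (Function.update a i b) := by
    ext x
    constructor
    · rintro ⟨hx, hl⟩
      refine ⟨hx.1, fun j => ?_⟩
      rcases eq_or_ne j i with rfl | hj
      · rw [hupi, hb]; linarith
      · rw [hupd j hj]; exact hx.2 j
    · rintro ⟨hx, hp⟩
      refine ⟨⟨hx, fun j => ?_⟩, ?_⟩
      · rcases eq_or_ne j i with rfl | hj
        · rw [hi]; exact zero_le_one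
        · rw [← hupd j hj]; exact hp j
      · have := hp i
        rw [hupi, hb] at this
        linarith
  have hmemQ : ∀ x, x ∈ halfspacePolytope M (Function.update a i b) ↔
      x ∈ halfspacePolytope M a ∧ 0 ≤ b x := fun x => by
    rw [← hQ, hb, sub_nonneg]; rfl
  have hface : ∀ τ, i ∉ τ → ∀ x, x ∈ tightFace M (Function.update a i b) τ ↔
      x ∈ tightFace M a τ ∧ 0 ≤ b x := by
    intro τ hτ x
    have : (∀ j ∈ τ, Function.update a i b j x = 0) ↔ ∀ j ∈ τ, a j x = 0 :=
      forall₂_congr fun j hj => by rw [hupd j (ne_of_mem_of_not_mem hj hτ)]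
    simp only [tightFace, mem_ofPred_eq, hmemQ, this]
    tauto
  have hface' : ∀ τ, i ∉ τ → ∀ x, x ∈ tightFace M (Function.update a i b) (insert i τ) ↔
      x ∈ tightFace M a τ ∧ b x = 0 := by
    intro τ hτ x
    have h1 := hface τ hτ x
    simp only [tightFace, mem_ofPred_eq, Finset.forall_mem_insert, hupi] at h1 ⊢
    constructor
    · rintro ⟨hx, h0, h2⟩; exact ⟨(h1.1 ⟨hx, h2⟩).1, h0⟩
    · rintro ⟨hx, h0⟩
      have := h1.2 ⟨hx, h0.ge⟩
      exact ⟨this.1, h0, this.2⟩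
  refine ⟨b, ⟨?_, ?_⟩, hQ, fun τ hτ => ⟨⟨?_, ?_⟩, ?_, ?_⟩⟩
  · rw [← hQ]
    exact h.compact.inter_right (isClosed_le l.continuous continuous_const)
  · intro x hx j hj
    obtain ⟨hxP, hxb⟩ := (hmemQ x).1 hx
    have key : b x = 0 →
        ∃ w ∈ M.direction, b.linear w = 1 ∧ ∀ k, a k x = 0 → (a k).linear w = 0 := by
      intro hb0
      let τ : Finset ι := {k | a k x = 0}
      by_contra! hcon
      -- If b depended on the functionals tight at x, it would vanish on the smallest face
      -- containing x. No vertex lies on b = 0, so this face would have no vertices and be empty,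
      -- although it contains x.
      have hzero : ∀ y ∈ tightFace M a τ, b y = 0 := by
        intro y hy
        by_contra hby
        obtain ⟨k, hk, hk'⟩ := hcon ((b y)⁻¹ • (y - x))
          (Submodule.smul_mem _ _ (AffineSubspace.vsub_mem_direction hy.1.1 hxP.1))
          (by rw [map_smul, affine_apply_sub, hb0, sub_zero, smul_eq_mul, inv_mul_cancel₀ hby])
        refine hk' ?_
        rw [map_smul, affine_apply_sub, hk, hy.2 k (by simpa [τ] using hk), sub_zero, smul_zero]
      refine (h.tightFace_subset_of_extremePoints τ convex_empty fun y hy hyτ => ?_)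
        (⟨hxP, fun k hk => by simpa [τ] using hk⟩ : x ∈ tightFace M a τ)
      have h0 := hzero y hyτ
      by_cases hyF : y ∈ tightFace M a σ
      · exact absurd h0 (hvF y hy hyF).ne
      · exact absurd h0 (hvN y hy hyF).ne'
    rcases eq_or_ne j i with rfl | hji
    · rw [hupi] at hj
      obtain ⟨w, hw, h1, h2⟩ := key hj
      exact ⟨w, hw, by rwa [hupi], fun k hk h0 => by rw [hupd k hk] at h0 ⊢; exact h2 k h0⟩
    · rw [hupd j hji] at hj ⊢
      obtain ⟨u, hu, h1, h2⟩ := h.indep x hxP j hj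
      by_cases hb0 : b x = 0
      · obtain ⟨w, hw, h3, h4⟩ := key hb0
        -- Subtracting a multiple of w makes the direction tangent to the new hyperplane without
        -- changing the old tight functionals.
        refine ⟨u - b.linear u • w, sub_mem hu (Submodule.smul_mem _ _ hw), ?_, fun k hk h0 => ?_⟩
        · rw [map_sub, map_smul, h1, h4 j hj, smul_zero, sub_zero]
        · rcases eq_or_ne k i with rfl | hki
          · rw [hupi, map_sub, map_smul, h3, smul_eq_mul, mul_one, sub_self]
          · rw [hupd k hki] at h0 ⊢
            rw [map_sub, map_smul, h2 k hk h0, h4 k h0, smul_zero, sub_zero]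
      · refine ⟨u, hu, h1, fun k hk h0 => ?_⟩
        rcases eq_or_ne k i with rfl | hki
        · rw [hupi] at h0; exact absurd h0 hb0
        · rw [hupd k hki] at h0 ⊢; exact h2 k hk h0
  · rintro ⟨x, hx⟩
    rw [hface τ hτ] at hx
    exact ⟨⟨x, hx.1⟩, fun hsub => absurd hx.2 (not_le.2 (hneg τ hsub x hx.1))⟩
  · rintro ⟨hne, hsub⟩
    obtain ⟨x, hx, hbx⟩ := hpos τ hne hsub
    exact ⟨x, (hface τ hτ x).2 ⟨hx, hbx.le⟩⟩
  · rintro ⟨x, hx⟩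
    rw [hface' τ hτ] at hx
    refine ⟨?_, fun hsub => (hneg τ hsub x hx.1).ne hx.2⟩
    by_contra hne
    exact (hdis τ hne x hx.1).ne' hx.2
  · rintro ⟨⟨y, hy⟩, hsub⟩
    have hyτ := tightFace_anti Finset.subset_union_left hy
    have hby := hneg _ Finset.subset_union_right y hy
    obtain ⟨x, hx, hbx⟩ := hpos τ ⟨y, hyτ⟩ hsub
    have hd : 0 < b x - b y := by linarith
    have hs : (-b y) / (b x - b y) + b x / (b x - b y) = 1 := by
      rw [← add_div, neg_add_eq_sub, div_self hd.ne']
    -- The point where the segment from x (b positive) to y (b negative), inside the face of τ,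
    -- meets the cutting hyperplane.
    refine ⟨((-b y) / (b x - b y)) • x + (b x / (b x - b y)) • y, (hface' τ hτ _).2 ⟨?_, ?_⟩⟩
    · exact convex_tightFace τ hx hyτ (div_nonneg (by linarith) hd.le)
        (div_nonneg hbx.le hd.le) hs
    · rw [affine_apply_combo b hs]
      field_simp
      ring

/-- Shift the supporting hyperplane of the face slightly inwards: only finitely many vertices have
to stay on the other side. -/
theorem IsSimpleSystem.exists_isTruncation (h : IsSimpleSystem M a) {σ : Finset ι}
    (hσ : (tightFace M a σ).Nonempty) (hne : σ.Nonempty) :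
    ∃ Q, IsTruncation (halfspacePolytope M a) (tightFace M a σ) Q := by
  obtain ⟨l, hl⟩ := isExposed_tightFace (M := M) (a := a) σ hσ
  obtain ⟨x₀, hx₀⟩ := hσ
  have hmax := hl ▸ hx₀
  have hS : ∀ x ∈ (halfspacePolytope M a).extremePoints ℝ, x ∉ tightFace M a σ → l x < l x₀ := by
    intro x hx hxF
    refine lt_of_le_of_ne (hmax.2 x hx.1) fun he => hxF ?_
    rw [hl]
    exact ⟨hx.1, fun y hy => he ▸ hmax.2 y hy⟩
  have hev : ∀ᶠ c in 𝓝[<] (l x₀), ∀ x ∈ (halfspacePolytope M a).extremePoints ℝ,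
      x ∉ tightFace M a σ → l x < c := by
    rw [eventually_all_finite finite_extremePoints_halfspacePolytope]
    intro x hx
    by_cases hxF : x ∈ tightFace M a σ
    · exact Eventually.of_forall fun _ hn => absurd hxF hn
    · filter_upwards [Ioo_mem_nhdsLT (hS x hx hxF)] with c hc _ using hc.1
  obtain ⟨c, hc, hc'⟩ := (hev.and self_mem_nhdsWithin).exists
  refine ⟨_, ⟨isExposed_tightFace σ, ⟨x₀, hx₀⟩, fun he => ?_⟩, l, c, fun x hx =>
    ⟨fun hxF => ?_, hc x hx⟩, rfl⟩
  · obtain ⟨i, hi⟩ := hne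
    have := (h.tightFace_subset_iff (σ := σ) (τ := ∅)
      (tightFace_empty (M := M) (a := a) ▸ ⟨x₀, hx₀.1⟩)).1 (by rw [tightFace_empty, he])
    exact absurd (this hi) (Finset.notMem_empty i)
  · rw [hl] at hxF
    exact lt_of_lt_of_le hc' (hxF.2 x₀ hx₀.1)

end Truncation

/-! ### The simplex in barycentric coordinates. -/

section Simplex

open Set

variable {E : Type*} [NormedAddCommGroup E] [NormedSpace ℝ E] {n : ℕ} {v : Fin n → E}

/-- The vertices are completed to an affine basis, so that the coordinates are defined on all of E
and not only on the span of the simplex. -/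
theorem exists_barycentric (hv : AffineIndependent ℝ v) :
    ∃ β : Fin n → E →ᵃ[ℝ] ℝ, ∀ i j, β i (v j) = if i = j then 1 else 0 := by
  classical
  obtain ⟨t, hst, ht, htop⟩ := exists_subset_affineIndependent_affineSpan_eq_top hv.range
  let b : AffineBasis t ℝ E := ⟨fun x => x.1, ht, by simpa using htop⟩
  have hmem : ∀ i, v i ∈ t := fun i => hst (mem_range_self i)
  refine ⟨fun i => b.coord ⟨v i, hmem i⟩, fun i j => ?_⟩
  refine (b.coord_apply ⟨v i, hmem i⟩ ⟨v j, hmem j⟩).trans ?_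
  simp only [Subtype.ext_iff, hv.injective.eq_iff]

theorem barycentric_sum {β : Fin n → E →ᵃ[ℝ] ℝ}
    (hβ : ∀ i j, β i (v j) = if i = j then 1 else 0) {x : E}
    (hx : x ∈ affineSpan ℝ (range v)) : ∑ i, β i x = 1 ∧ ∑ i, β i x • v i = x := by
  obtain ⟨w, hw, rfl⟩ := eq_affineCombination_of_mem_affineSpan_of_fintype hx
  have hβw : ∀ i, β i (Finset.univ.affineCombination ℝ v w) = w i := by
    intro i
    rw [Finset.map_affineCombination _ _ _ hw,
      Finset.affineCombination_eq_linear_combination _ _ _ hw]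
    simp [hβ]
  simp only [hβw]
  exact ⟨hw, (Finset.affineCombination_eq_linear_combination _ _ _ hw).symm⟩

/-- Barycentric coordinates, together with trivial inequalities to be replaced by truncations. -/
def barycentricSystem (β : Fin n → E →ᵃ[ℝ] ℝ) : Fin n ⊕ Finset (Fin n) → E →ᵃ[ℝ] ℝ :=
  Sum.elim β fun _ => AffineMap.const ℝ E 1

theorem simplex_eq {β : Fin n → E →ᵃ[ℝ] ℝ} (hβ : ∀ i j, β i (v j) = if i = j then 1 else 0) :
    simplex v = halfspacePolytope (affineSpan ℝ (range v)) (barycentricSystem β) := by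
  refine subset_antisymm (convexHull_min ?_ convex_halfspacePolytope) fun x hx => ?_
  · rintro _ ⟨j, rfl⟩
    refine ⟨mem_affineSpan ℝ (mem_range_self j), ?_⟩
    rintro (i | S)
    · simp only [barycentricSystem, Sum.elim_inl, hβ]; split_ifs <;> norm_num
    · simp [barycentricSystem]
  · obtain ⟨h1, h2⟩ := barycentric_sum hβ hx.1
    rw [← h2]
    exact (convex_convexHull ℝ _).sum_mem (fun i _ => hx.2 (Sum.inl i)) h1
      fun i _ => subset_convexHull ℝ _ (mem_range_self i)

theorem mem_facet_iff {β : Fin n → E →ᵃ[ℝ] ℝ} (hβ : ∀ i j, β i (v j) = if i = j then 1 else 0)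
    {x : E} (hx : x ∈ simplex v) (i : Fin n) : x ∈ facet v i ↔ β i x = 0 := by
  constructor
  · refine fun h => convexHull_min ?_ (convex_setOf_affine_eq (β i) 0) h
    rintro _ ⟨j, hj, rfl⟩
    have : i ≠ j := fun h => hj h.symm
    simp [hβ, this]
  · intro h0
    rw [simplex_eq hβ] at hx
    obtain ⟨h1, h2⟩ := barycentric_sum hβ hx.1
    rw [← Finset.sum_erase (f := fun j => β j x) (a := i) _ h0] at h1
    rw [← Finset.sum_erase (f := fun j => β j x • v j) (a := i) _ (by rw [h0, zero_smul])] at h2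
    rw [← h2]
    exact (convex_convexHull ℝ _).sum_mem (fun j _ => hx.2 (Sum.inl j)) h1
      fun j hj => subset_convexHull ℝ _ (mem_image_of_mem v (Finset.ne_of_mem_erase hj))

theorem simplexFace_eq {β : Fin n → E →ᵃ[ℝ] ℝ} (hβ : ∀ i j, β i (v j) = if i = j then 1 else 0)
    (S : Finset (Fin n)) : simplexFace v S =
      tightFace (affineSpan ℝ (range v)) (barycentricSystem β) (S.disjSum ∅) := by
  ext x
  simp only [simplexFace, tightFace, mem_ofPred_eq, ← simplex_eq hβ]
  refine and_congr_right fun hx => ?_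
  simp [mem_facet_iff hβ hx, barycentricSystem]

/-- The coordinates sum to 1, so some coordinate j is nonzero at the point; the direction `v i - v
j` then changes coordinate i and no other vanishing one. -/
theorem isSimpleSystem_barycentric {β : Fin n → E →ᵃ[ℝ] ℝ}
    (hβ : ∀ i j, β i (v j) = if i = j then 1 else 0) :
    IsSimpleSystem (affineSpan ℝ (range v)) (barycentricSystem β) := by
  refine ⟨simplex_eq hβ ▸ (finite_range v).isCompact_convexHull ℝ, ?_⟩
  rintro x hx (i | S) hi
  · obtain ⟨h1, -⟩ := barycentric_sum hβ hx.1
    obtain ⟨j, -, hj⟩ := Finset.exists_ne_zero_of_sum_ne_zero (h1.trans_ne one_ne_zero)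
    have hij : i ≠ j := by rintro rfl; exact hj hi
    refine ⟨v i - v j, AffineSubspace.vsub_mem_direction (mem_affineSpan ℝ (mem_range_self i))
      (mem_affineSpan ℝ (mem_range_self j)), ?_, ?_⟩
    · simp [affine_apply_sub, barycentricSystem, hβ, hij]
    · rintro (k | S) hk h0
      · have hki : k ≠ i := fun h => hk (by rw [h])
        have hkj : k ≠ j := by rintro rfl; exact hj h0
        simp [affine_apply_sub, barycentricSystem, hβ, hki, hkj]
      · simp [barycentricSystem] at h0
  · simp [barycentricSystem] at hi

theorem tightFace_barycentric_nonempty_iff {β : Fin n → E →ᵃ[ℝ] ℝ}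
    (hβ : ∀ i j, β i (v j) = if i = j then 1 else 0) (B : Finset (Fin n))
    (N : Finset (Finset (Fin n))) :
    (tightFace (affineSpan ℝ (range v)) (barycentricSystem β) (B.disjSum N)).Nonempty ↔
      N = ∅ ∧ B ≠ Finset.univ := by
  constructor
  · rintro ⟨x, hx, h0⟩
    constructor
    · refine Finset.eq_empty_of_forall_notMem fun S hS => ?_
      have := h0 (Sum.inr S) (Finset.inr_mem_disjSum.2 hS)
      simp [barycentricSystem] at this
    · rintro rfl
      have h1 := (barycentric_sum hβ hx.1).1
      have h2 : ∀ i, β i x = 0 := fun i =>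
        h0 (Sum.inl i) (Finset.inl_mem_disjSum.2 (Finset.mem_univ i))
      simp [h2] at h1
  · rintro ⟨rfl, hB⟩
    obtain ⟨j, hj⟩ : ∃ j, j ∉ B := by
      by_contra! h
      exact hB (Finset.eq_univ_of_forall h)
    refine ⟨v j, simplex_eq hβ ▸ subset_convexHull ℝ _ (mem_range_self j), ?_⟩
    rintro (i | S) hi
    · have : i ≠ j := by rintro rfl; exact hj (Finset.inl_mem_disjSum.1 hi)
      simp [barycentricSystem, hβ, this]
    · simp at hi

end Simplex

/-! ### Unfolding the iterated stellar subdivision. -/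

section NestedComplex

variable {α : Type*} [DecidableEq α]

/-- The simplicial complex obtained from the boundary complex of a simplex by stellar subdivisions
at the faces in the list `T`, the last one first. The vertices are those of the simplex (`B`) and
the new ones (`N`), labelled by the subdivided faces. -/
def SubdividedComplex [Fintype α] : List (Finset α) → Finset α → Finset (Finset α) → Prop
  | [], B, N => N = ∅ ∧ B ≠ Finset.univ
  -- A set containing the new vertex S is a simplex if its remaining part, which must not contain
  -- the face S, spans a simplex together with S before the subdivision.
  | S :: T, B, N => ¬ S ⊆ B ∧
      if S ∈ N then SubdividedComplex T (B ∪ S) (N.erase S) else SubdividedComplex T B N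

variable [Fintype α]

theorem subdividedComplex_empty_iff {T : List (Finset α)} {B : Finset α} :
    SubdividedComplex T B ∅ ↔ B ≠ Finset.univ ∧ ∀ U ∈ T, ¬ U ⊆ B := by
  induction T with
  | nil => simp [SubdividedComplex]
  | cons S T ih =>
    simp only [SubdividedComplex, Finset.notMem_empty, if_false, ih, List.forall_mem_cons]
    tauto

/-- When the recursion reaches U, all strictly smaller members of N have been merged into the first
argument, which must not contain U. At the end of the list everything has been merged. -/
theorem SubdividedComplex.not_cover {T : List (Finset α)} {B : Finset α} {N : Finset (Finset α)}
    (hT : T.Pairwise fun S U => S.card ≤ U.card) (h : SubdividedComplex T B N) :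
    (∀ S ∈ N, S ∈ T) ∧ (¬ ∀ x, x ∈ B ∨ ∃ A ∈ N, x ∈ A) ∧
      ∀ U ∈ T, ¬ ∀ x ∈ U, x ∈ B ∨ ∃ A ∈ N, A.card < U.card ∧ x ∈ A := by
  induction T generalizing B N with
  | nil =>
    obtain ⟨rfl, hB⟩ := h
    refine ⟨by simp, fun hc => hB (Finset.eq_univ_of_forall fun x => ?_), by simp⟩
    simpa using hc x
  | cons S T ih =>
    rw [List.pairwise_cons] at hT
    obtain ⟨hS, h⟩ := h
    have hN : (∀ A ∈ N, A ∈ S :: T) ∧ (¬ ∀ x, x ∈ B ∨ ∃ A ∈ N, x ∈ A) ∧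
        ∀ U ∈ T, ¬ ∀ x ∈ U, x ∈ B ∨ ∃ A ∈ N, A.card < U.card ∧ x ∈ A := by
      split_ifs at h with hSN
      · obtain ⟨h1, h2, h3⟩ := ih hT.2 h
        refine ⟨fun A hA => ?_, fun hc => h2 fun x => ?_, fun U hU hc => h3 U hU fun x hx => ?_⟩
        · by_cases he : A = S
          · exact he ▸ List.mem_cons_self
          · exact List.mem_cons_of_mem _ (h1 A (Finset.mem_erase.2 ⟨he, hA⟩))
        · rcases hc x with hx | ⟨A, hA, hx⟩
          · exact Or.inl (Finset.mem_union_left _ hx)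
          · by_cases he : A = S
            · exact Or.inl (Finset.mem_union_right _ (he ▸ hx))
            · exact Or.inr ⟨A, Finset.mem_erase.2 ⟨he, hA⟩, hx⟩
        · rcases hc x hx with hx | ⟨A, hA, hc, hx⟩
          · exact Or.inl (Finset.mem_union_left _ hx)
          · by_cases he : A = S
            · exact Or.inl (Finset.mem_union_right _ (he ▸ hx))
            · exact Or.inr ⟨A, Finset.mem_erase.2 ⟨he, hA⟩, hc, hx⟩
      · obtain ⟨h1, h2, h3⟩ := ih hT.2 h
        exact ⟨fun A hA => List.mem_cons_of_mem _ (h1 A hA), h2, h3⟩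
    refine ⟨hN.1, hN.2.1, fun U hU => ?_⟩
    rcases List.mem_cons.1 hU with rfl | hU
    · refine fun hc => hS fun x hx => ?_
      rcases hc x hx with hx | ⟨A, hA, hc, -⟩
      · exact hx
      · rcases List.mem_cons.1 (hN.1 A hA) with rfl | hAT
        · exact absurd hc (lt_irrefl _)
        · exact absurd (hT.1 A hAT) (not_le.2 hc)
    · exact hN.2.2 U hU

/-- The bound on cardinalities is not strict here, unlike in `SubdividedComplex.not_cover`: members
as large as U may be merged before U, depending on the order. Compatibility will close this gap. -/
theorem subdividedComplex_of_not_cover {T : List (Finset α)} {B : Finset α}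
    {N : Finset (Finset α)} (hT : T.Pairwise fun S U => S.card ≤ U.card) (hT' : T.Nodup)
    (hN : ∀ S ∈ N, S ∈ T) (huniv : ¬ ∀ x, x ∈ B ∨ ∃ A ∈ N, x ∈ A)
    (h : ∀ U ∈ T, ¬ ∀ x ∈ U, x ∈ B ∨ ∃ A ∈ N, A ≠ U ∧ A.card ≤ U.card ∧ x ∈ A) :
    SubdividedComplex T B N := by
  induction T generalizing B N with
  | nil =>
    refine ⟨Finset.eq_empty_of_forall_notMem fun S hS => absurd (hN S hS) (by simp), ?_⟩
    rintro rfl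
    exact huniv fun x => Or.inl (Finset.mem_univ x)
  | cons S T ih =>
    rw [List.pairwise_cons] at hT
    rw [List.nodup_cons] at hT'
    refine ⟨fun hS => h S List.mem_cons_self fun x hx => Or.inl (hS hx), ?_⟩
    split_ifs with hSN
    · refine ih hT.2 hT'.2 (fun A hA => ?_) (fun hc => huniv fun x => ?_)
        fun U hU hc => h U (List.mem_cons_of_mem _ hU) fun x hx => ?_
      · rw [Finset.mem_erase] at hA
        exact (List.mem_cons.1 (hN A hA.2)).resolve_left hA.1
      · rcases hc x with hx | ⟨A, hA, hx⟩
        · exact (Finset.mem_union.1 hx).imp id fun hx => ⟨S, hSN, hx⟩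
        · exact Or.inr ⟨A, Finset.mem_of_mem_erase hA, hx⟩
      · rcases hc x hx with hx | ⟨A, hA, hc⟩
        · exact (Finset.mem_union.1 hx).imp id fun hx =>
            ⟨S, hSN, fun he => hT'.1 (he ▸ hU), hT.1 U hU, hx⟩
        · exact Or.inr ⟨A, Finset.mem_of_mem_erase hA, hc⟩
    · refine ih hT.2 hT'.2 (fun A hA => ?_) huniv fun U hU => h U (List.mem_cons_of_mem _ hU)
      refine (List.mem_cons.1 (hN A hA)).resolve_left ?_
      rintro rfl
      exact hSN hA

end NestedComplex

/-! ### Realizing the subdivisions by iterated truncation. -/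

section IteratedTruncation

open Set

variable {E : Type*} [NormedAddCommGroup E] [NormedSpace ℝ E]
  {n : ℕ} {v : Fin n → E} {β : Fin n → E →ᵃ[ℝ] ℝ}

/-- The system of inequalities reached after the truncations in the list `T`, the last one
first. -/
structure IsTruncatedSystem (v : Fin n → E) (β : Fin n → E →ᵃ[ℝ] ℝ) (T : List (Finset (Fin n)))
    (a : Fin n ⊕ Finset (Fin n) → E →ᵃ[ℝ] ℝ) : Prop where
  isSimple : IsSimpleSystem (affineSpan ℝ (range v)) a
  inl : ∀ i, a (Sum.inl i) = β i
  inr : ∀ S, S ∉ T → ∀ x, a (Sum.inr S) x = 1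
  nonempty_iff : ∀ B N, (tightFace (affineSpan ℝ (range v)) a (B.disjSum N)).Nonempty ↔
    SubdividedComplex T B N

theorem isTruncatedSystem_nil (hβ : ∀ i j, β i (v j) = if i = j then 1 else 0) :
    IsTruncatedSystem v β [] (barycentricSystem β) :=
  ⟨isSimpleSystem_barycentric hβ, fun _ => rfl, fun _ _ _ => rfl,
    tightFace_barycentric_nonempty_iff hβ⟩

variable {T : List (Finset (Fin n))} {a : Fin n ⊕ Finset (Fin n) → E →ᵃ[ℝ] ℝ}

/-- Truncations replace only the trivial inequalities, so what is left of an original face is still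
cut out by the same barycentric coordinates. -/
theorem IsTruncatedSystem.simplexFace_inter (h : IsTruncatedSystem v β T a)
    (hβ : ∀ i j, β i (v j) = if i = j then 1 else 0) (S : Finset (Fin n)) :
    simplexFace v S ∩ halfspacePolytope (affineSpan ℝ (range v)) a =
      tightFace (affineSpan ℝ (range v)) a (S.disjSum ∅) := by
  rw [simplexFace_eq hβ]
  ext x
  constructor
  · rintro ⟨⟨-, h0⟩, hx⟩
    refine ⟨hx, ?_⟩
    rintro (i | U) hi
    · rw [h.inl]; exact h0 _ hi
    · simp at hi
  · rintro ⟨hx, h0⟩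
    refine ⟨⟨⟨hx.1, ?_⟩, ?_⟩, hx⟩
    · rintro (i | U)
      · have := hx.2 (Sum.inl i)
        rwa [h.inl] at this
      · simp [barycentricSystem]
    · rintro (i | U) hi
      · have := h0 _ hi
        rwa [h.inl] at this
      · simp at hi

variable [FiniteDimensional ℝ E]

theorem IsTruncatedSystem.step (h : IsTruncatedSystem v β T a)
    (hβ : ∀ i j, β i (v j) = if i = j then 1 else 0) {S : Finset (Fin n)} (hS : S ∉ T) {Q : Set E}
    (hQ : IsTruncation (halfspacePolytope (affineSpan ℝ (range v)) a)
      (simplexFace v S ∩ halfspacePolytope (affineSpan ℝ (range v)) a) Q) :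
    ∃ a', IsTruncatedSystem v β (S :: T) a' ∧
      Q = halfspacePolytope (affineSpan ℝ (range v)) a' := by
  rw [h.simplexFace_inter hβ] at hQ
  obtain ⟨b, h1, h2, h3⟩ := h.isSimple.truncate (i := Sum.inr S) (h.inr S hS) hQ
  have hsub : ∀ B N, S.disjSum (∅ : Finset (Finset (Fin n))) ⊆ B.disjSum N ↔ S ⊆ B := by
    intro B N
    simp [Finset.subset_iff]
  refine ⟨_, ⟨h1, fun i => ?_, fun U hU x => ?_, fun B N => ?_⟩, h2⟩
  · rw [Function.update_of_ne (by simp), h.inl]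
  · rw [List.mem_cons, not_or] at hU
    rw [Function.update_of_ne (by simpa using hU.1), h.inr U hU.2]
  · rw [SubdividedComplex]
    split_ifs with hSN
    · have := (h3 (B.disjSum (N.erase S)) (by simp)).2
      have hins : insert (Sum.inr S) (B.disjSum (N.erase S)) = B.disjSum N := by
        ext (x | x)
        · simp
        · by_cases hx : x = S <;> simp [hx, hSN]
      have hun : B.disjSum (N.erase S) ∪ S.disjSum ∅ = (B ∪ S).disjSum (N.erase S) := by
        ext (x | x) <;> simp
      rw [hins, hun, h.nonempty_iff, hsub] at this
      rw [this, and_comm]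
    · have := (h3 (B.disjSum N) (by simpa using hSN)).1
      rw [h.nonempty_iff, hsub] at this
      rw [this, and_comm]

theorem IsTruncatedSystem.exists_isTruncation (h : IsTruncatedSystem v β T a)
    (hβ : ∀ i j, β i (v j) = if i = j then 1 else 0) {S : Finset (Fin n)} (hne : S.Nonempty)
    (huniv : S ≠ Finset.univ) (hT : ∀ U ∈ T, ¬ U ⊆ S) :
    ∃ Q, IsTruncation (halfspacePolytope (affineSpan ℝ (range v)) a)
      (simplexFace v S ∩ halfspacePolytope (affineSpan ℝ (range v)) a) Q := by
  rw [h.simplexFace_inter hβ]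
  refine h.isSimple.exists_isTruncation
    ((h.nonempty_iff _ _).2 (subdividedComplex_empty_iff.2 ⟨huniv, hT⟩)) ?_
  obtain ⟨i, hi⟩ := hne
  exact ⟨Sum.inl i, Finset.inl_mem_disjSum.2 hi⟩

theorem IsTruncatedSystem.iterate (h : IsTruncatedSystem v β T a)
    (hβ : ∀ i j, β i (v j) = if i = j then 1 else 0) (L : List (Finset (Fin n)))
    (hne : ∀ S ∈ L, S.Nonempty ∧ S ≠ Finset.univ)
    (hLT : (T.reverse ++ L).Pairwise fun S U => U.card ≤ S.card)
    (hnd : (T.reverse ++ L).Nodup) :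
    (∃ Q, IsIteratedTruncation (halfspacePolytope (affineSpan ℝ (range v)) a)
      (L.map (simplexFace v)) Q) ∧
    ∀ Q, IsIteratedTruncation (halfspacePolytope (affineSpan ℝ (range v)) a)
      (L.map (simplexFace v)) Q →
      ∃ a', IsTruncatedSystem v β (L.reverse ++ T) a' ∧
        Q = halfspacePolytope (affineSpan ℝ (range v)) a' := by
  induction L generalizing T a with
  | nil =>
    refine ⟨⟨_, rfl⟩, fun Q hQ => ⟨a, by simpa using h, hQ⟩⟩
  | cons S L ih =>
    have hlist : T.reverse ++ S :: L = (S :: T).reverse ++ L := by simp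
    have hST : S ∉ T := fun hS =>
      (List.nodup_append.1 hnd).2.2 S (List.mem_reverse.2 hS) S List.mem_cons_self rfl
    -- The sets treated earlier have at least as many nodes as S and differ from it, so none is
    -- contained in S and the face of S has survived.
    have hsub : ∀ U ∈ T, ¬ U ⊆ S := by
      intro U hU hUS
      have := (List.pairwise_append.1 hLT).2.2 U (List.mem_reverse.2 hU) S List.mem_cons_self
      exact hST (Finset.eq_of_subset_of_card_le hUS this ▸ hU)
    rw [hlist] at hLT hnd
    obtain ⟨hS, hL⟩ := List.forall_mem_cons.1 hne
    constructor
    · obtain ⟨R, hR⟩ := h.exists_isTruncation hβ hS.1 hS.2 hsub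
      obtain ⟨a', h', rfl⟩ := h.step hβ hST hR
      obtain ⟨Q, hQ⟩ := (ih h' hL hLT hnd).1
      exact ⟨Q, _, hR, hQ⟩
    · rintro Q ⟨R, hR, hQ⟩
      obtain ⟨a', h', rfl⟩ := h.step hβ hST hR
      obtain ⟨a'', h'', hQ'⟩ := (ih h' hL hLT hnd).2 Q hQ
      exact ⟨a'', by simpa using h'', hQ'⟩

/-- Translates the order by dimension into the order by number of nodes. -/
theorem dim_simplexFace (hv : AffineIndependent ℝ v) {S : Finset (Fin n)} (hS : S ≠ Finset.univ) :
    dim (simplexFace v S) + S.card = Module.finrank ℝ (vectorSpan ℝ (range v)) := by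
  obtain ⟨β, hβ⟩ := exists_barycentric hv
  have h := isTruncatedSystem_nil hβ
  rw [simplexFace_eq hβ, ← direction_affineSpan, ← h.isSimple.dim_tightFace (σ := S.disjSum ∅)
    ((h.nonempty_iff _ _).2 ⟨rfl, hS⟩)]
  simp

end IteratedTruncation

/-! ### Compatible connected sets of nodes. -/

section Tubes

variable {V : Type*} {G : SimpleGraph V}

/-- Two sets of vertices are compatible if they are nested, or disjoint and not joined by any
edge. -/
def Compatible (G : SimpleGraph V) (S T : Finset V) : Prop :=
  S ⊆ T ∨ T ⊆ S ∨ ∀ x ∈ S, ∀ y ∈ T, x ≠ y ∧ ¬ G.Adj x y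

theorem Compatible.symm {S T : Finset V} (h : Compatible G S T) : Compatible G T S := by
  rcases h with h | h | h
  · exact Or.inr (Or.inl h)
  · exact Or.inl h
  · exact Or.inr (Or.inr fun x hx y hy => ⟨(h y hy x hx).1.symm, fun ha => (h y hy x hx).2 ha.symm⟩)

theorem forall_mem_of_preconnected {S : Set V} (hS : (G.induce S).Preconnected) {p : V → Prop}
    {x : V} (hx : x ∈ S) (hp : p x)
    (hstep : ∀ y ∈ S, ∀ z ∈ S, G.Adj y z → p y → p z) : ∀ z ∈ S, p z := by
  intro z hz
  have hr := hS ⟨x, hx⟩ ⟨z, hz⟩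
  rw [SimpleGraph.reachable_iff_reflTransGen] at hr
  suffices ∀ w, Relation.ReflTransGen (G.induce S).Adj ⟨x, hx⟩ w → p w.1 from this _ hr
  intro w hw
  induction hw with
  | refl => exact hp
  | tail _ hadj ih => exact hstep _ (Subtype.property _) _ (Subtype.property _) hadj ih

/-- A maximal covering set through one point of S cannot be left along an edge of S: the set
covering the other end would be compatible with it, hence inside it. -/
theorem exists_subset_of_pairwise_compatible {S : Finset V}
    (hS : (G.induce (S : Set V)).Connected) (𝓜 : Set (Finset V))
    (hM : ∀ A ∈ 𝓜, ∀ B ∈ 𝓜, Compatible G A B) (hfin : 𝓜.Finite)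
    (hcov : ∀ x ∈ S, ∃ A ∈ 𝓜, x ∈ A) : ∃ A ∈ 𝓜, S ⊆ A := by
  obtain ⟨⟨x, hx⟩⟩ := hS.nonempty
  obtain ⟨A₀, hA₀, hxA₀⟩ := hcov x hx
  obtain ⟨A, hA, hmax⟩ := (hfin.subset (Set.sep_subset 𝓜 (x ∈ ·))).exists_maximal ⟨A₀, hA₀, hxA₀⟩
  refine ⟨A, hA.1, fun z hz => ?_⟩
  refine forall_mem_of_preconnected (p := (· ∈ A)) hS.preconnected hx hA.2 ?_ z hz
  intro y hy z hz hyz hyA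
  obtain ⟨C, hC, hzC⟩ := hcov z hz
  rcases hM A hA.1 C hC with h | h | h
  · exact hmax ⟨hC, h hA.2⟩ h hzC
  · exact h hzC
  · exact absurd hyz (h y hyA z hzC).2

theorem connected_union_of_not_compatible [DecidableEq V] {S T : Finset V}
    (hS : (G.induce (S : Set V)).Connected) (hT : (G.induce (T : Set V)).Connected)
    (h : ¬ Compatible G S T) : (G.induce ((S ∪ T : Finset V) : Set V)).Connected := by
  have : ∃ x ∈ S, ∃ y ∈ T, x = y ∨ G.Adj x y := by
    by_contra! hc
    exact h (Or.inr (Or.inr hc))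
  obtain ⟨x, hx, y, hy, rfl | hxy⟩ := this
  · rw [Finset.coe_union]
    exact SimpleGraph.induce_union_connected hS.preconnected hT.preconnected ⟨x, hx, hy⟩
  · have h1 := SimpleGraph.induce_union_connected hS.preconnected
      (SimpleGraph.induce_pair_connected_of_adj hxy).preconnected ⟨x, hx, by simp⟩
    have h2 := SimpleGraph.induce_union_connected h1.preconnected hT.preconnected
      ⟨y, by simp, hy⟩
    have he : ((S ∪ T : Finset V) : Set V) = (S : Set V) ∪ {x, y} ∪ (T : Set V) := by
      ext z
      simp only [Finset.coe_union, Set.mem_union, Finset.mem_coe, Set.mem_insert_iff,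
        Set.mem_singleton_iff]
      constructor
      · tauto
      · rintro ((h | rfl | rfl) | h) <;> tauto
    rwa [he]

variable {n : ℕ}

/-- After all the subdivisions, the simplices are the sets of pairwise compatible tubes. -/
theorem subdividedComplex_iff_compatible {T : List (Finset (Fin n))}
    (hn : 1 ≤ n) (hT : T.Pairwise fun S U => S.card ≤ U.card) (hnd : T.Nodup)
    (htube : ∀ S ∈ T, IsConnectedSubdiagram S)
    (hall : ∀ S : Finset (Fin n), IsConnectedSubdiagram S → 2 ≤ S.card → S ∈ T)
    {B : Finset (Fin n)} {N : Finset (Finset (Fin n))} :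
    SubdividedComplex T B N ↔
      (∀ b ∈ B, IsConnectedSubdiagram {b} ∧ {b} ∉ T) ∧ (∀ S ∈ N, S ∈ T) ∧
      ∀ S U, (S ∈ N ∨ ∃ b ∈ B, S = {b}) → (U ∈ N ∨ ∃ b ∈ B, U = {b}) →
        Compatible (SimpleGraph.cycleGraph n) S U := by
  obtain ⟨m, rfl⟩ : ∃ m, n = m + 1 := ⟨n - 1, by omega⟩
  have hsing : ∀ b : Fin (m + 1), ((SimpleGraph.cycleGraph (m + 1)).induce
      (({b} : Finset (Fin (m + 1))) : Set (Fin (m + 1)))).Connected := by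
    intro b
    rw [Finset.coe_singleton]
    exact SimpleGraph.Connected.mk fun x y => by
      rw [Subsingleton.elim x y]
  constructor
  · intro h
    obtain ⟨h1, h2, h3⟩ := h.not_cover hT
    have hmem : ∀ S, (S ∈ N ∨ ∃ b ∈ B, S = {b}) →
        ((SimpleGraph.cycleGraph (m + 1)).induce (S : Set (Fin (m + 1)))).Connected ∧
        ∀ x ∈ S, x ∈ B ∨ ∃ A ∈ N, x ∈ A := by
      rintro S (hS | ⟨b, hb, rfl⟩)
      · exact ⟨(htube S (h1 S hS)).1, fun x hx => Or.inr ⟨S, hS, hx⟩⟩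
      · exact ⟨hsing b, fun x hx => Or.inl (Finset.mem_singleton.1 hx ▸ hb)⟩
    -- If {b} is in T, the original facet b has been cut off entirely, so b is not a vertex of the
    -- complex.
    refine ⟨fun b hb => ⟨⟨hsing b, fun he => h2 fun x => Or.inl ?_⟩, fun hbT => ?_⟩, h1,
      fun S U hS hU => ?_⟩
    · have : x ∈ ({b} : Finset (Fin (m + 1))) := he ▸ Finset.mem_univ x
      exact Finset.mem_singleton.1 this ▸ hb
    · exact h3 _ hbT fun x hx => Or.inl (Finset.mem_singleton.1 hx ▸ hb)
    · by_contra hc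
      -- The union is connected and strictly larger than both S and U. It is either the whole cycle
      -- or a truncated set covered by smaller members, and `not_cover` excludes both.
      have hcon := connected_union_of_not_compatible (hmem S hS).1 (hmem U hU).1 hc
      have hcov : ∀ x ∈ S ∪ U, x ∈ B ∨ ∃ A ∈ N, x ∈ A := fun x hx =>
        (Finset.mem_union.1 hx).elim ((hmem S hS).2 x) ((hmem U hU).2 x)
      have hne : S ∪ U ≠ Finset.univ := fun he => h2 fun x => hcov x (he ▸ Finset.mem_univ x)
      have hcS : S.card < (S ∪ U).card := Finset.card_lt_card
        (Finset.ssubset_iff_subset_ne.2 ⟨Finset.subset_union_left, fun he =>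
          hc (Or.inr (Or.inl (he ▸ Finset.subset_union_right)))⟩)
      have hcU : U.card < (S ∪ U).card := Finset.card_lt_card
        (Finset.ssubset_iff_subset_ne.2 ⟨Finset.subset_union_right, fun he =>
          hc (Or.inl (he ▸ Finset.subset_union_left))⟩)
      have hpos : 0 < S.card := by
        obtain ⟨⟨x, hx⟩⟩ := (hmem S hS).1.nonempty
        exact Finset.card_pos.2 ⟨x, hx⟩
      refine h3 _ (hall _ ⟨hcon, hne⟩ (by omega)) fun x hx => ?_
      have hone : ∀ A, (A ∈ N ∨ ∃ b ∈ B, A = {b}) → A.card < (S ∪ U).card → x ∈ A →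
          x ∈ B ∨ ∃ A ∈ N, A.card < (S ∪ U).card ∧ x ∈ A := by
        rintro A (hA | ⟨b, hb, rfl⟩) hcard hxA
        · exact Or.inr ⟨A, hA, hcard, hxA⟩
        · exact Or.inl (Finset.mem_singleton.1 hxA ▸ hb)
      rcases Finset.mem_union.1 hx with hx | hx
      · exact hone S hS hcS hx
      · exact hone U hU hcU hx
  · rintro ⟨h1, h2, h3⟩
    -- The original facets in B count as one-node sets in the covering; p records the size
    -- restriction.
    have hcover : ∀ S : Finset (Fin (m + 1)),
        ((SimpleGraph.cycleGraph (m + 1)).induce (S : Set (Fin (m + 1)))).Connected →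
        ∀ p : Finset (Fin (m + 1)) → Prop,
        (∀ x ∈ S, x ∈ B ∨ ∃ A ∈ N, p A ∧ x ∈ A) →
        (∃ A ∈ N, p A ∧ S ⊆ A) ∨ ∃ b ∈ B, S ⊆ {b} := by
      intro S hS p hcov
      obtain ⟨A, hA, hSA⟩ := exists_subset_of_pairwise_compatible hS
        {A | (A ∈ N ∧ p A) ∨ ∃ b ∈ B, A = {b}}
        (fun A hA C hC => h3 A C (hA.imp And.left id) (hC.imp And.left id)) (Set.toFinite _)
        (fun x hx => (hcov x hx).elim
          (fun hxB => ⟨{x}, Or.inr ⟨x, hxB, rfl⟩, Finset.mem_singleton_self x⟩)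
          fun ⟨A, hA, hp, hxA⟩ => ⟨A, Or.inl ⟨hA, hp⟩, hxA⟩)
      rcases hA with hA | ⟨b, hb, rfl⟩
      · exact Or.inl ⟨A, hA.1, hA.2, hSA⟩
      · exact Or.inr ⟨b, hb, hSA⟩
    have huniv : ((SimpleGraph.cycleGraph (m + 1)).induce
        ((Finset.univ : Finset (Fin (m + 1))) : Set (Fin (m + 1)))).Connected := by
      rw [Finset.coe_univ]
      exact (SimpleGraph.induceUnivIso _).connected_iff.2 SimpleGraph.cycleGraph_connected
    refine subdividedComplex_of_not_cover hT hnd h2 (fun hc => ?_) fun U hU hc => ?_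
    · rcases hcover _ huniv (fun _ => True) (fun x _ => by simpa using hc x) with
        ⟨A, hA, -, hsub⟩ | ⟨b, hb, hsub⟩
      · exact (htube A (h2 A hA)).2 (Finset.univ_subset_iff.1 hsub)
      · exact (h1 b hb).1.2 (Finset.univ_subset_iff.1 hsub)
    · rcases hcover U (htube U hU).1 (fun A => A ≠ U ∧ A.card ≤ U.card)
        (fun x hx => by simpa [and_assoc] using hc x hx) with
        ⟨A, hA, ⟨hne, hcard⟩, hsub⟩ | ⟨b, hb, hsub⟩
      · exact hne (Finset.eq_of_subset_of_card_le hsub hcard).symm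
      · obtain ⟨⟨x, hx⟩⟩ := (htube U hU).1.nonempty
        have : U = {b} := Finset.Nonempty.subset_singleton_iff ⟨x, hx⟩ |>.1 hsub
        exact (h1 b hb).2 (this ▸ hU)

end Tubes

/-! ### Proper connected subdiagrams of the cycle are arcs. -/

section Arcs

open SimpleGraph

theorem cycleGraph_adj_iff_val {n : ℕ} {u v : Fin n} : (cycleGraph n).Adj u v ↔
    2 ≤ n ∧ (u.val + 1 = v.val ∨ v.val + 1 = u.val ∨ (u.val = 0 ∧ v.val + 1 = n) ∨
      (v.val = 0 ∧ u.val + 1 = n)) := by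
  have hsub : ∀ a b : Fin n, (a - b).val = if b.val ≤ a.val then a.val - b.val
      else n + a.val - b.val := by
    intro a b
    have ha := a.isLt
    have hb := b.isLt
    have hab : (a - b).val = (n - b.val + a.val) % n := by rw [Fin.sub_def]
    rw [hab]
    split_ifs with h
    · rw [show n - b.val + a.val = a.val - b.val + n by omega, Nat.add_mod_right,
        Nat.mod_eq_of_lt (by omega)]
    · rw [Nat.mod_eq_of_lt (by omega)]
      omega
  have hu := u.isLt
  have hv := v.isLt
  rw [cycleGraph_adj', hsub, hsub]
  split_ifs <;> omega

/-- The arc `fst + 1, …, snd - 1` (modulo `n`) of the cycle. -/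
@[ext]
structure ArcIndex (n : ℕ) where
  fst : ℕ
  snd : ℕ
  fst_lt : fst < n
  le_snd : fst + 2 ≤ snd
  snd_le : snd ≤ fst + n

namespace ArcIndex

variable {n : ℕ}

/-- The nodes of the arc. -/
def arc (I : ArcIndex n) : Finset (Fin n) :=
  -- The end `snd` is not reduced modulo n; the second alternative is the part of the arc beyond
  -- node n - 1.
  {x | (I.fst < x.val ∧ x.val < I.snd) ∨ x.val + n < I.snd}

theorem mem_arc {I : ArcIndex n} {x : Fin n} :
    x ∈ I.arc ↔ (I.fst < x.val ∧ x.val < I.snd) ∨ x.val + n < I.snd := by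
  simp [arc]

/-- The node before the arc. -/
def left (I : ArcIndex n) : Fin n := ⟨I.fst, I.fst_lt⟩

/-- The node after the arc. -/
def right (I : ArcIndex n) : Fin n :=
  ⟨if I.snd < n then I.snd else I.snd - n, by
    have := I.fst_lt; have := I.snd_le; split_ifs <;> omega⟩

/-- The first node of the arc. -/
def start (I : ArcIndex n) : Fin n :=
  ⟨if I.fst + 1 < n then I.fst + 1 else 0, by have := I.fst_lt; split_ifs <;> omega⟩

/-- The last node of the arc. -/
def last (I : ArcIndex n) : Fin n :=
  ⟨if I.snd ≤ n then I.snd - 1 else I.snd - 1 - n, by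
    have := I.fst_lt; have := I.snd_le; have := I.le_snd; split_ifs <;> omega⟩

variable (I : ArcIndex n)

theorem left_notMem : I.left ∉ I.arc := by
  have := I.fst_lt; have := I.snd_le
  simp only [mem_arc, left]
  omega

theorem right_notMem : I.right ∉ I.arc := by
  have := I.fst_lt; have := I.snd_le
  simp only [mem_arc, right]
  split_ifs <;> omega

theorem start_mem : I.start ∈ I.arc := by
  have := I.fst_lt; have := I.le_snd
  simp only [mem_arc, start]
  split_ifs <;> omega

theorem last_mem : I.last ∈ I.arc := by
  have := I.fst_lt; have := I.le_snd; have := I.snd_le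
  simp only [mem_arc, last]
  split_ifs <;> omega

theorem adj_left_start : (cycleGraph n).Adj I.left I.start := by
  have := I.fst_lt; have := I.le_snd; have := I.snd_le
  simp only [cycleGraph_adj_iff_val, left, start]
  split_ifs <;> omega

theorem adj_right_last : (cycleGraph n).Adj I.right I.last := by
  have := I.fst_lt; have := I.le_snd; have := I.snd_le
  simp only [cycleGraph_adj_iff_val, right, last]
  split_ifs <;> omega

variable {I}

theorem mem_or_eq_of_adj {y z : Fin n} (hy : y ∈ I.arc) (hyz : (cycleGraph n).Adj y z) :
    z ∈ I.arc ∨ z = I.left ∨ z = I.right := by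
  have := I.fst_lt; have := I.le_snd; have := I.snd_le
  have := y.isLt; have := z.isLt
  simp only [cycleGraph_adj_iff_val, mem_arc, left, right, Fin.ext_iff] at *
  split_ifs <;> omega

theorem connected_arc (I : ArcIndex n) :
    ((cycleGraph n).induce (I.arc : Set (Fin n))).Connected := by
  obtain ⟨p, q, hp, hpq, hqn⟩ := I
  induction q, hpq using Nat.le_induction with
  | base =>
    have : ((ArcIndex.mk p (p + 2) hp le_rfl hqn).arc : Set (Fin n)) =
        {(ArcIndex.mk p (p + 2) hp le_rfl hqn).start} := by
      ext x
      have := x.isLt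
      simp only [Finset.mem_coe, mem_arc, Set.mem_singleton_iff, start, Fin.ext_iff]
      split_ifs <;> omega
    rw [this]
    exact Connected.mk fun x y => by rw [Subsingleton.elim x y]
  | succ q hq ih =>
    let I := ArcIndex.mk p q hp hq (by omega)
    have h : ((ArcIndex.mk p (q + 1) hp (by omega) hqn).arc : Set (Fin n)) =
        (I.arc : Set (Fin n)) ∪ {I.right, I.last} := by
      ext x
      have := x.isLt
      simp only [I, Finset.mem_coe, mem_arc, Set.mem_union, Set.mem_insert_iff,
        Set.mem_singleton_iff, right, last, Fin.ext_iff]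
      split_ifs <;> omega
    rw [h]
    exact induce_union_connected (ih (by omega)).preconnected
      (induce_pair_connected_of_adj I.adj_right_last).preconnected ⟨_, I.last_mem, by simp⟩

theorem isConnectedSubdiagram_arc (I : ArcIndex n) : IsConnectedSubdiagram I.arc :=
  ⟨I.connected_arc, fun h => I.left_notMem (h ▸ Finset.mem_univ _)⟩

/-- Walk forward from a node outside S until S is entered, then until it is left. The arc in between
lies in S and both its neighbours do not, so the connected set S cannot extend beyond it. -/
theorem exists_arc_eq {S : Finset (Fin n)} (hS : IsConnectedSubdiagram S) :
    ∃ I : ArcIndex n, I.arc = S := by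
  classical
  obtain ⟨hconn, huniv⟩ := hS
  obtain ⟨⟨s, hs⟩⟩ := hconn.nonempty
  obtain ⟨y, hy⟩ : ∃ y, y ∉ S := by
    by_contra! h
    exact huniv (Finset.eq_univ_of_forall h)
  have hn : 0 < n := y.pos
  let node : ℕ → Fin n := fun m => ⟨m % n, Nat.mod_lt _ hn⟩
  have hnode : ∀ x : Fin n, node x.val = x := fun x => Fin.ext (Nat.mod_eq_of_lt x.isLt)
  have hnode' : ∀ m, node (m + n) = node m := fun m => Fin.ext (Nat.add_mod_right m n)
  have hex : ∃ k, node (y.val + k) ∈ S := ⟨n - y.val + s.val, by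
    have := y.isLt
    rw [show y.val + (n - y.val + s.val) = s.val + n by omega, hnode', hnode]
    exact hs⟩
  -- As y is outside S, the first node of S is met after at least one step, and k leads to the node
  -- just before it.
  obtain ⟨k, hk⟩ : ∃ k, k + 1 = Nat.find hex := by
    refine Nat.exists_eq_add_one_of_ne_zero (fun h0 => hy ?_) |>.imp fun _ h => h.symm
    have := Nat.find_spec hex
    rwa [h0, add_zero, hnode] at this
  set p : ℕ := (node (y.val + k)).val with hp
  have hpn : p < n := Fin.isLt _
  have hpS : node p ∉ S := by
    rw [hp, hnode]
    exact Nat.find_min hex (by omega)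
  have hpS' : node (p + 1) ∈ S := by
    have h1 : node (p + 1) = node (y.val + (k + 1)) := Fin.ext (by simp [p, node, add_assoc])
    rw [h1, hk]
    exact Nat.find_spec hex
  have hex' : ∃ j, node (p + 1 + j) ∉ S := ⟨n - 1, by
    rw [show p + 1 + (n - 1) = p + n by omega, hnode']
    exact hpS⟩
  have hj0 : Nat.find hex' ≠ 0 := fun h0 => by
    have := Nat.find_spec hex'
    rw [h0] at this
    exact this hpS'
  have hjn : Nat.find hex' ≤ n - 1 := Nat.find_min' hex' (by
    rw [show p + 1 + (n - 1) = p + n by omega, hnode']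
    exact hpS)
  have hjS := Nat.find_spec hex'
  have hmin : ∀ j < Nat.find hex', node (p + 1 + j) ∈ S := fun j hj => by
    simpa using Nat.find_min hex' hj
  set j := Nat.find hex'
  let I : ArcIndex n := ⟨p, p + 1 + j, hpn, by omega, by omega⟩
  have hl : I.left ∉ S := by rwa [← hnode I.left]
  have hr : I.right ∉ S := by
    have : I.right = node (p + 1 + j) := by
      rw [← hnode I.right]
      simp only [right, I]
      split_ifs with h
      · rfl
      · rw [← hnode']
        congr 1
        omega
    rwa [this]
  have hsub : I.arc ⊆ S := by
    intro x hx
    rw [mem_arc] at hx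
    rcases hx with ⟨h1, h2⟩ | h2
    · have := hmin (x.val - (p + 1)) (by simp only [I] at h1 h2; omega)
      rwa [show p + 1 + (x.val - (p + 1)) = x.val by simp only [I] at h1; omega, hnode] at this
    · have := hmin (x.val + n - (p + 1)) (by simp only [I] at h2; omega)
      rwa [show p + 1 + (x.val + n - (p + 1)) = x.val + n by omega, hnode', hnode] at this
  refine ⟨I, subset_antisymm hsub fun z hz => ?_⟩
  refine forall_mem_of_preconnected (p := (· ∈ I.arc)) hconn.preconnected
    (hsub I.start_mem) I.start_mem ?_ z hz
  intro a _ b hb hab haI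
  rcases mem_or_eq_of_adj haI hab with h | rfl | rfl
  · exact h
  · exact absurd hb hl
  · exact absurd hb hr

/-- The two ends are read off from the nodes where the cycle enters and leaves the arc. -/
theorem arc_injective : Function.Injective (arc : ArcIndex n → Finset (Fin n)) := by
  intro I J h
  have hmem : ∀ x, x ∈ I.arc ↔ x ∈ J.arc := fun x => by rw [h]
  have := I.fst_lt; have := I.le_snd; have := I.snd_le
  have := J.fst_lt; have := J.le_snd; have := J.snd_le
  have hfst : I.fst = J.fst := by
    have h1 := mt (hmem I.left).2 I.left_notMem
    have h2 := (hmem I.start).1 I.start_mem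
    simp only [mem_arc, left, start] at h1 h2
    split_ifs at h2 <;> omega
  refine ArcIndex.ext hfst ?_
  have h1 := mt (hmem I.right).2 I.right_notMem
  have h2 := mt (hmem J.right).1 J.right_notMem
  simp only [mem_arc, right] at h1 h2
  split_ifs at h1 h2 <;> omega

/-- Two arcs are incompatible if and only if each of them contains a node next to the other. -/
theorem compatible_arc_iff {I J : ArcIndex n} : Compatible (cycleGraph n) I.arc J.arc ↔
    ¬ ((I.left ∈ J.arc ∨ I.right ∈ J.arc) ∧ (J.left ∈ I.arc ∨ J.right ∈ I.arc)) := by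
  have key : ∀ {I J : ArcIndex n}, ¬ (I.left ∈ J.arc ∨ I.right ∈ J.arc) →
      Compatible (cycleGraph n) I.arc J.arc := by
    intro I J h
    rw [not_or] at h
    have hstep : ∀ y ∈ I.arc, ∀ z ∈ J.arc, (cycleGraph n).Adj y z → z ∈ I.arc := by
      intro y hy z hz hyz
      rcases mem_or_eq_of_adj hy hyz with h' | rfl | rfl
      · exact h'
      · exact absurd hz h.1
      · exact absurd hz h.2
    by_cases hx : ∃ x, x ∈ I.arc ∧ x ∈ J.arc
    · obtain ⟨x, hxI, hxJ⟩ := hx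
      exact Or.inr (Or.inl (forall_mem_of_preconnected (p := (· ∈ I.arc))
        J.connected_arc.preconnected hxJ hxI fun y _ z hz hyz hy => hstep y hy z hz hyz))
    · push Not at hx
      exact Or.inr (Or.inr fun x hxI y hyJ => ⟨fun he => hx x hxI (he ▸ hyJ),
        fun hxy => hx y (hstep x hxI y hyJ hxy) hyJ⟩)
  constructor
  · rintro (h | h | h) ⟨hI, hJ⟩
    · exact hJ.elim (fun hJ => J.left_notMem (h hJ)) fun hJ => J.right_notMem (h hJ)
    · exact hI.elim (fun hI => I.left_notMem (h hI)) fun hI => I.right_notMem (h hI)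
    · rcases hI with hI | hI
      · exact (h _ I.start_mem _ hI).2 I.adj_left_start.symm
      · exact (h _ I.last_mem _ hI).2 I.adj_right_last.symm
  · intro h
    rw [not_and_or] at h
    exact h.elim key fun h => (key h).symm

end ArcIndex

end Arcs

/-! ### Arcs of the cycle and symmetric diagonals of the 2n-gon. -/

section Diagonals

variable {n : ℕ}

theorem antipode_val (a : Fin (2 * n)) :
    (antipode a).val = if a.val < n then a.val + n else a.val - n := by
  have := a.isLt
  simp only [antipode]
  split_ifs with h
  · exact Nat.mod_eq_of_lt (by omega)
  · rw [show a.val + n = a.val - n + 2 * n by omega, Nat.add_mod_right,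
      Nat.mod_eq_of_lt (by omega)]

theorem antipode_antipode (a : Fin (2 * n)) : antipode (antipode a) = a := by
  have := a.isLt
  refine Fin.ext ?_
  rw [antipode_val, antipode_val]
  split_ifs <;> omega

theorem cross_mk_iff {x y x' y' : Fin (2 * n)} (h : x < y) (h' : x' < y') :
    Cross s(x, y) s(x', y') ↔
      (x.val < x'.val ∧ x'.val < y.val ∧ y.val < y'.val) ∨
      (x'.val < x.val ∧ x.val < y'.val ∧ y'.val < y.val) := by
  constructor
  · rintro ⟨a, b, a', b', h1, h2, h3, ⟨h4, h5⟩ | ⟨h4, h5⟩⟩ <;>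
    · rw [Sym2.eq_iff] at h4 h5
      simp only [Fin.lt_def, Fin.ext_iff] at *
      omega
  · rintro (⟨h1, h2, h3⟩ | ⟨h1, h2, h3⟩)
    · exact ⟨x, x', y, y', h1, h2, h3, Or.inl ⟨rfl, rfl⟩⟩
    · exact ⟨x', x, y', y, h1, h2, h3, Or.inr ⟨rfl, rfl⟩⟩

namespace ArcIndex

/-- The smaller end point of the diagonal that cuts off the arc. -/
def lower (I : ArcIndex n) : Fin (2 * n) := ⟨I.fst, by have := I.fst_lt; omega⟩

/-- The larger end point of the diagonal that cuts off the arc. -/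
def upper (I : ArcIndex n) : Fin (2 * n) :=
  ⟨I.snd, by have := I.fst_lt; have := I.snd_le; omega⟩

theorem antipode_lower_val (I : ArcIndex n) : (antipode I.lower).val = I.fst + n :=
  (antipode_val _).trans (if_pos I.fst_lt)

theorem antipode_upper_val (I : ArcIndex n) :
    (antipode I.upper).val = if I.snd < n then I.snd + n else I.snd - n :=
  antipode_val _

theorem lower_lt_upper (I : ArcIndex n) : I.lower < I.upper :=
  Fin.lt_def.2 (lt_of_lt_of_le (Nat.lt_add_of_pos_right two_pos) I.le_snd)

/-- The symmetric diagonal that cuts off the arc. -/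
def symDiagonal (I : ArcIndex n) : SymDiagonal n :=
  ⟨{s(I.lower, I.upper), s(I.lower, I.upper).map antipode}, s(I.lower, I.upper),
    ⟨I.lower, I.upper, rfl, by
      have := I.le_snd; simp only [lower, upper]; omega, by
      have := I.le_snd; have := I.snd_le; simp only [lower, upper]; omega⟩, rfl⟩

theorem mem_symDiagonal {I : ArcIndex n} {d : Sym2 (Fin (2 * n))} : d ∈ I.symDiagonal.1 ↔
    d = s(I.lower, I.upper) ∨ d = s(I.lower, I.upper).map antipode := by
  simp [symDiagonal]

theorem symDiagonal_injective : Function.Injective (symDiagonal : ArcIndex n → SymDiagonal n) := by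
  intro I J h
  have hmem : s(I.lower, I.upper) ∈ J.symDiagonal.1 := by
    rw [← h, mem_symDiagonal]
    exact Or.inl rfl
  simp only [mem_symDiagonal, Sym2.map_mk, Sym2.eq_iff, Fin.ext_iff, antipode_lower_val,
    antipode_upper_val] at hmem
  have := I.fst_lt; have := I.le_snd; have := I.snd_le
  have := J.fst_lt; have := J.le_snd; have := J.snd_le
  simp only [lower, upper] at hmem
  rw [ArcIndex.ext_iff]
  split_ifs at hmem <;> omega

theorem symDiagonal_surjective :
    Function.Surjective (symDiagonal : ArcIndex n → SymDiagonal n) := by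
  rintro ⟨c, d, ⟨a, b, rfl, hab, hba⟩, rfl⟩
  have hb := b.isLt
  have key : ∀ u w : Fin (2 * n), u.val < n → u.val + 2 ≤ w.val → w.val ≤ u.val + n →
      ∃ I : ArcIndex n, I.symDiagonal.1 = {s(u, w), s(u, w).map antipode} :=
    fun u w h1 h2 h3 => ⟨⟨u, w, h1, h2, h3⟩, rfl⟩
  have hanti : ∀ u w : Fin (2 * n), s(antipode u, antipode w) = s(a, b) →
      ({s(u, w), s(u, w).map antipode} : Finset (Sym2 (Fin (2 * n)))) =
        {s(a, b), s(a, b).map antipode} := by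
    intro u w h
    rw [← h]
    simp only [Sym2.map_mk, antipode_antipode]
    exact Finset.pair_comm _ _
  simp only [Subtype.ext_iff]
  have ha' := antipode_val a
  have hb' := antipode_val b
  -- The diagonal itself has the required form if it starts in the first half and spans at most n
  -- steps. Otherwise its antipodal image does, with the ends exchanged when a lies in the first
  -- half.
  by_cases han : a.val < n
  · by_cases hlen : b.val ≤ a.val + n
    · exact key a b han hab hlen
    · rw [if_pos han] at ha'
      rw [if_neg (by omega)] at hb'
      rw [← hanti (antipode b) (antipode a) (by simp [antipode_antipode, Sym2.eq_swap])]
      exact key _ _ (by omega) (by omega) (by omega)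
  · rw [if_neg han] at ha'
    rw [if_neg (by omega)] at hb'
    rw [← hanti (antipode a) (antipode b) (by simp [antipode_antipode])]
    exact key _ _ (by omega) (by omega) (by omega)

/-- Puts the ends of the antipodal diagonal in increasing order, as `cross_mk_iff` requires; the
order depends on whether `snd` wraps around modulo n. -/
theorem exists_antipodal (I : ArcIndex n) : ∃ u w : Fin (2 * n), u < w ∧
    s(I.lower, I.upper).map antipode = s(u, w) ∧
    ((I.snd < n ∧ u.val = I.fst + n ∧ w.val = I.snd + n) ∨
      (n ≤ I.snd ∧ u.val = I.snd - n ∧ w.val = I.fst + n)) := by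
  have := I.fst_lt; have := I.le_snd; have := I.snd_le
  have h1 := I.antipode_lower_val
  have h2 := I.antipode_upper_val
  by_cases h : I.snd < n
  · rw [if_pos h] at h2
    exact ⟨antipode I.lower, antipode I.upper, by rw [Fin.lt_def]; omega, rfl,
      Or.inl ⟨h, h1, h2⟩⟩
  · rw [if_neg h] at h2
    exact ⟨antipode I.upper, antipode I.lower, by rw [Fin.lt_def]; omega, Sym2.eq_swap,
      Or.inr ⟨not_lt.1 h, h2, h1⟩⟩

/-- Symmetric diagonals do not intersect if and only if the arcs they cut off are compatible. -/
theorem not_cross_iff_compatible {I J : ArcIndex n} :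
    (∀ d ∈ I.symDiagonal.1, ∀ d' ∈ J.symDiagonal.1, ¬ Cross d d') ↔
      Compatible (SimpleGraph.cycleGraph n) I.arc J.arc := by
  obtain ⟨u, w, huw, hI, huwI⟩ := I.exists_antipodal
  obtain ⟨u', w', huw', hJ, huwJ⟩ := J.exists_antipodal
  have := I.fst_lt; have := I.le_snd; have := I.snd_le
  have := J.fst_lt; have := J.le_snd; have := J.snd_le
  rw [compatible_arc_iff]
  simp only [mem_symDiagonal, hI, hJ, forall_eq_or_imp, forall_eq,
    cross_mk_iff I.lower_lt_upper J.lower_lt_upper, cross_mk_iff I.lower_lt_upper huw',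
    cross_mk_iff huw J.lower_lt_upper, cross_mk_iff huw huw', mem_arc, left, right]
  simp only [lower, upper]
  -- Once the wrapping of both arcs is fixed, crossing and adjacency are linear inequalities between
  -- the four ends.
  rcases huwI with ⟨h1, h2, h3⟩ | ⟨h1, h2, h3⟩ <;> rcases huwJ with ⟨h4, h5, h6⟩ | ⟨h4, h5, h6⟩ <;>
    rw [h2, h3, h5, h6] <;> split_ifs <;> omega

end ArcIndex

end Diagonals

/-! ### Facets of the truncated simplex labelled by arcs. -/

section Labelling

variable {n : ℕ} {L : List (Finset (Fin n))}

namespace ArcIndex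

open Classical in
/-- The facet of the truncated simplex that corresponds to an arc. -/
noncomputable def label (L : List (Finset (Fin n))) (I : ArcIndex n) : Fin n ⊕ Finset (Fin n) :=
  -- An arc outside L is a single node whose facet was not truncated, so the original facet still
  -- represents it.
  if I.arc ∈ L then Sum.inr I.arc else Sum.inl I.start

theorem arc_eq_of_notMem (hL : ∀ S : Finset (Fin n), IsConnectedSubdiagram S → 2 ≤ S.card → S ∈ L)
    {I : ArcIndex n} (h : I.arc ∉ L) : I.arc = {I.start} := by
  have h1 : I.arc.card ≤ 1 := by
    by_contra hc
    exact h (hL _ I.isConnectedSubdiagram_arc (by omega))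
  exact Finset.eq_singleton_iff_unique_mem.2 ⟨I.start_mem, fun x hx =>
    Finset.card_le_one.1 h1 x hx _ I.start_mem⟩

theorem label_eq_inr {I : ArcIndex n} {S : Finset (Fin n)} :
    I.label L = Sum.inr S ↔ I.arc = S ∧ S ∈ L := by
  rw [label]
  split_ifs with h
  · rw [Sum.inr.injEq]
    exact ⟨fun he => ⟨he, he ▸ h⟩, And.left⟩
  · simp only [false_iff, not_and]
    rintro rfl
    exact h

theorem label_eq_inl (hL : ∀ S : Finset (Fin n), IsConnectedSubdiagram S → 2 ≤ S.card → S ∈ L)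
    {I : ArcIndex n} {b : Fin n} : I.label L = Sum.inl b ↔ I.arc = {b} ∧ {b} ∉ L := by
  rw [label]
  split_ifs with h
  · simp only [false_iff, not_and, not_not]
    exact fun he => he ▸ h
  · have he := arc_eq_of_notMem hL h
    rw [Sum.inl.injEq]
    constructor
    · rintro rfl
      exact ⟨he, he ▸ h⟩
    · rintro ⟨h1, -⟩
      rwa [he, Finset.singleton_inj] at h1

theorem label_injective
    (hL : ∀ S : Finset (Fin n), IsConnectedSubdiagram S → 2 ≤ S.card → S ∈ L) :
    Function.Injective (label L) := by
  intro I J h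
  refine arc_injective ?_
  rcases hJ : J.label L with b | S
  · rw [((label_eq_inl hL).1 hJ).1, ((label_eq_inl hL).1 (h.trans hJ)).1]
  · rw [(label_eq_inr.1 hJ).1, (label_eq_inr.1 (h.trans hJ)).1]

/-- The node sets represented by B and N are the arcs of D, whichever single nodes were truncated.
-/
theorem exists_label_eq_iff
    (hL : ∀ S : Finset (Fin n), IsConnectedSubdiagram S → 2 ≤ S.card → S ∈ L) (D : Finset (ArcIndex n))
    {B : Finset (Fin n)} {N : Finset (Finset (Fin n))}
    (hD : ∀ x, x ∈ B.disjSum N ↔ ∃ I ∈ D, I.label L = x) (S : Finset (Fin n)) :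
    (S ∈ N ∨ ∃ b ∈ B, S = {b}) ↔ ∃ I ∈ D, I.arc = S := by
  have hB : ∀ b, b ∈ B ↔ ∃ I ∈ D, I.label L = Sum.inl b := fun b => by rw [← hD]; simp
  have hN : ∀ S, S ∈ N ↔ ∃ I ∈ D, I.label L = Sum.inr S := fun b => by rw [← hD]; simp
  constructor
  · rintro (hS | ⟨b, hb, rfl⟩)
    · obtain ⟨I, hI, h⟩ := (hN S).1 hS
      exact ⟨I, hI, (label_eq_inr.1 h).1⟩
    · obtain ⟨I, hI, h⟩ := (hB b).1 hb
      exact ⟨I, hI, ((label_eq_inl hL).1 h).1⟩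
  · rintro ⟨I, hI, rfl⟩
    rcases h : I.label L with b | S
    · exact Or.inr ⟨b, (hB b).2 ⟨I, hI, h⟩, ((label_eq_inl hL).1 h).1⟩
    · exact Or.inl ((label_eq_inr.1 h).1 ▸ (hN S).2 ⟨I, hI, h⟩)

end ArcIndex

theorem subdividedComplex_iff_exists_arcs {T : List (Finset (Fin n))}
    (hn : 1 ≤ n) (hT : T.Pairwise fun S U => S.card ≤ U.card) (hnd : T.Nodup)
    (htube : ∀ S ∈ T, IsConnectedSubdiagram S)
    (hall : ∀ S : Finset (Fin n), IsConnectedSubdiagram S → 2 ≤ S.card → S ∈ T)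
    {B : Finset (Fin n)} {N : Finset (Finset (Fin n))} :
    SubdividedComplex T B N ↔ ∃ D : Finset (ArcIndex n),
      D.map ⟨ArcIndex.label T, ArcIndex.label_injective hall⟩ = B.disjSum N ∧
      ∀ I ∈ D, ∀ J ∈ D, Compatible (SimpleGraph.cycleGraph n) I.arc J.arc := by
  rw [subdividedComplex_iff_compatible hn hT hnd htube hall]
  constructor
  · rintro ⟨h1, h2, h3⟩
    have hrange : ∀ x ∈ B.disjSum N, ∃ I : ArcIndex n, I.label T = x := by
      rintro (b | S) hx
      · obtain ⟨hb, hbT⟩ := h1 b (Finset.inl_mem_disjSum.1 hx)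
        obtain ⟨I, hI⟩ := ArcIndex.exists_arc_eq hb
        exact ⟨I, (ArcIndex.label_eq_inl hall).2 ⟨hI, hbT⟩⟩
      · have hS := h2 S (Finset.inr_mem_disjSum.1 hx)
        obtain ⟨I, hI⟩ := ArcIndex.exists_arc_eq (htube S hS)
        exact ⟨I, ArcIndex.label_eq_inr.2 ⟨hI, hS⟩⟩
    let D := (B.disjSum N).preimage _ (ArcIndex.label_injective hall).injOn
    have hD : ∀ x, x ∈ B.disjSum N ↔ ∃ I ∈ D, I.label T = x := by
      intro x
      constructor
      · intro hx
        obtain ⟨I, rfl⟩ := hrange x hx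
        exact ⟨I, Finset.mem_preimage.2 hx, rfl⟩
      · rintro ⟨I, hI, rfl⟩
        exact Finset.mem_preimage.1 hI
    refine ⟨D, ?_, fun I hI J hJ => h3 _ _ ?_ ?_⟩
    · ext x
      simp [hD]
    · exact (ArcIndex.exists_label_eq_iff hall D hD _).2 ⟨I, hI, rfl⟩
    · exact (ArcIndex.exists_label_eq_iff hall D hD _).2 ⟨J, hJ, rfl⟩
  · rintro ⟨D, hD, hcomp⟩
    have hD' : ∀ x, x ∈ B.disjSum N ↔ ∃ I ∈ D, I.label T = x := by
      intro x
      rw [← hD]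
      simp
    refine ⟨fun b hb => ?_, fun S hS => ?_, fun S U hS hU => ?_⟩
    · obtain ⟨I, -, hI⟩ := (hD' _).1 (Finset.inl_mem_disjSum.2 hb)
      obtain ⟨h1, h2⟩ := (ArcIndex.label_eq_inl hall).1 hI
      exact ⟨h1 ▸ I.isConnectedSubdiagram_arc, h2⟩
    · obtain ⟨I, -, hI⟩ := (hD' _).1 (Finset.inr_mem_disjSum.2 hS)
      exact (ArcIndex.label_eq_inr.1 hI).2
    · obtain ⟨I, hI, rfl⟩ := (ArcIndex.exists_label_eq_iff hall D hD' S).1 hS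
      obtain ⟨J, hJ, rfl⟩ := (ArcIndex.exists_label_eq_iff hall D hD' U).1 hU
      exact hcomp I hI J hJ

/-- The symmetric diagonals are indexed by the arcs of the cycle. -/
noncomputable def arcIndexEquiv (n : ℕ) : ArcIndex n ≃ SymDiagonal n :=
  Equiv.ofBijective _ ⟨ArcIndex.symDiagonal_injective, ArcIndex.symDiagonal_surjective⟩

theorem forall_compatible_iff (D : Finset (SymDiagonal n)) :
    (∀ I ∈ D.map (arcIndexEquiv n).symm.toEmbedding,
      ∀ J ∈ D.map (arcIndexEquiv n).symm.toEmbedding,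
        Compatible (SimpleGraph.cycleGraph n) I.arc J.arc) ↔
      ∀ c ∈ D, ∀ c' ∈ D, ∀ d ∈ c.1, ∀ d' ∈ c'.1, ¬ Cross d d' := by
  simp only [Finset.forall_mem_map, Equiv.coe_toEmbedding, ← ArcIndex.not_cross_iff_compatible]
  have h : ∀ c, ((arcIndexEquiv n).symm c).symDiagonal = c := (arcIndexEquiv n).apply_symm_apply
  simp only [h]

/-- The simplices of the subdivided complex form the poset of symmetric dissections. -/
theorem exists_symDissection_orderIso {T : List (Finset (Fin n))}
    (hn : 1 ≤ n) (hT : T.Pairwise fun S U => S.card ≤ U.card) (hnd : T.Nodup)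
    (htube : ∀ S ∈ T, IsConnectedSubdiagram S)
    (hall : ∀ S : Finset (Fin n), IsConnectedSubdiagram S → 2 ≤ S.card → S ∈ T)
    {p : Finset (Fin n ⊕ Finset (Fin n)) → Prop}
    (hp : ∀ B N, p (B.disjSum N) ↔ SubdividedComplex T B N) :
    ∃ f : SymDissection n ≃o {σ // p σ}, ∀ D, (f D).1.card = D.1.card := by
  -- Symmetric diagonals are sent to facets through their arcs. Taking images under this injection
  -- preserves inclusion and cardinality.
  let φ : SymDiagonal n ↪ Fin n ⊕ Finset (Fin n) := (arcIndexEquiv n).symm.toEmbedding.trans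
    ⟨ArcIndex.label T, ArcIndex.label_injective hall⟩
  have hp' : ∀ σ, p σ ↔ ∃ D : Finset (SymDiagonal n), D.map φ = σ ∧
      ∀ c ∈ D, ∀ c' ∈ D, ∀ d ∈ c.1, ∀ d' ∈ c'.1, ¬ Cross d d' := by
    intro σ
    rw [← Finset.toLeft_disjSum_toRight (u := σ), hp,
      subdividedComplex_iff_exists_arcs hn hT hnd htube hall]
    constructor
    · rintro ⟨D, hD, hcomp⟩
      have hDD : (D.map (arcIndexEquiv n).toEmbedding).map (arcIndexEquiv n).symm.toEmbedding
          = D := by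
        ext I
        simp
      refine ⟨D.map (arcIndexEquiv n).toEmbedding, ?_, ?_⟩
      · rw [← hD, ← Finset.map_map, hDD]
      · rwa [← forall_compatible_iff, hDD]
    · rintro ⟨D, hD, hcross⟩
      exact ⟨_, by rw [← hD, ← Finset.map_map], (forall_compatible_iff D).2 hcross⟩
  let f : SymDissection n → {σ // p σ} := fun D => ⟨D.1.map φ, (hp' _).2 ⟨D.1, rfl, D.2⟩⟩
  refine ⟨⟨Equiv.ofBijective f ⟨fun D D' h => ?_, ?_⟩, fun {D D'} => ?_⟩, fun D => ?_⟩
  · exact Subtype.ext (Finset.map_injective φ (congrArg Subtype.val h))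
  · rintro ⟨σ, hσ⟩
    obtain ⟨D, rfl, hD⟩ := (hp' σ).1 hσ
    exact ⟨⟨D, hD⟩, rfl⟩
  · exact Finset.map_subset_map
  · exact Finset.card_map φ

end Labelling

end Trunk

/-! ### The truncated simplex is a cyclohedron. -/

theorem proposition4p3p1 {E : Type*} [NormedAddCommGroup E] [NormedSpace ℝ E]
    [FiniteDimensional ℝ E] (n : ℕ) (hn : 1 ≤ n)
    (v : Fin n → E) (hv : AffineIndependent ℝ v)
    (L : List (Finset (Fin n))) (hL : Trunk.IsTruncationOrder v L) :
    (∃ Q : Set E, Trunk.IsIteratedTruncation (Trunk.simplex v)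
        (L.map (Trunk.simplexFace v)) Q) ∧
      ∀ Q : Set E, Trunk.IsIteratedTruncation (Trunk.simplex v)
        (L.map (Trunk.simplexFace v)) Q → Trunk.IsCyclohedron n Q := by
  obtain ⟨hnd, htube, hall, hdim⟩ := hL
  obtain ⟨β, hβ⟩ := Trunk.exists_barycentric hv
  have hcard : L.Pairwise fun S U => U.card ≤ S.card := by
    refine hdim.imp_of_mem fun {S U} hS hU h => ?_
    have h1 := Trunk.dim_simplexFace hv (htube S hS).2
    have h2 := Trunk.dim_simplexFace hv (htube U hU).2
    omega
  have hne : ∀ S ∈ L, S.Nonempty ∧ S ≠ Finset.univ := by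
    intro S hS
    obtain ⟨⟨x, hx⟩⟩ := (htube S hS).1.nonempty
    exact ⟨⟨x, hx⟩, (htube S hS).2⟩
  have hiter := (Trunk.isTruncatedSystem_nil hβ).iterate hβ L hne (by simpa using hcard)
    (by simpa using hnd)
  rw [← Trunk.simplex_eq hβ] at hiter
  refine ⟨hiter.1, fun Q hQ => ?_⟩
  obtain ⟨a, ha, rfl⟩ := hiter.2 Q hQ
  rw [List.append_nil] at ha
  obtain ⟨f, hf⟩ := Trunk.exists_symDissection_orderIso hn (T := L.reverse)
    (p := fun σ => (Trunk.tightFace (affineSpan ℝ (Set.range v)) a σ).Nonempty)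
    (List.pairwise_reverse.2 hcard) (List.nodup_reverse.2 hnd)
    (fun S hS => htube S (List.mem_reverse.1 hS))
    (fun S hS h2 => List.mem_reverse.2 (hall S hS h2)) ha.nonempty_iff
  -- The empty dissection already gives a nonempty face, so Q is nonempty.
  have hempty : (Trunk.tightFace (affineSpan ℝ (Set.range v)) a ∅).Nonempty := by
    have h := f ⟨∅, by simp⟩
    exact h.2.mono (Trunk.tightFace_anti (Finset.empty_subset _))
  have hdimQ := ha.isSimple.dim_tightFace hempty
  rw [Trunk.tightFace_empty, Finset.card_empty, add_zero] at hdimQ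
  refine ⟨ha.isSimple.isPolytope, by rwa [Trunk.tightFace_empty] at hempty, ?_,
    ha.isSimple.facesEquiv.symm.trans f.symm.dual, fun F => ?_⟩
  · have := hv.finrank_vectorSpan (n := n - 1) (by rw [Fintype.card_fin]; omega)
    rw [hdimQ, direction_affineSpan, this]
    omega
  -- The codimension of a face is its number of tight functionals, which f identifies with the
  -- number of symmetric diagonals.
  · obtain ⟨σ, rfl⟩ := ha.isSimple.facesEquiv.surjective F
    have h1 := ha.isSimple.dim_tightFace (OrderDual.ofDual σ).2
    have h2 := hf (f.symm (OrderDual.ofDual σ))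
    rw [OrderIso.apply_symm_apply] at h2
    rw [hdimQ, ← h1, h2, OrderIso.trans_apply, OrderIso.symm_apply_apply]
    rfl
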